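/- Consider $11$-dimensional space-time with coordinates $(t,x^1,\dots,x^{10})$ and signature $(-,+,\dots,+)$. The $B_{11}$-model (truncated $11$-dimensional supergravity) has the action $\int d^{11}z\sqrt{|g|}\,\{R[g]-\frac1{4!}(F^4)^2\}$ with $F^4=dA$ a $4$-form; its equations of motion are $$R_{MN}-\tfrac12 g_{MN}R=\tfrac1{4!}\bigl(4F_{MPQR}F_N{}^{PQR}-\tfrac12 g_{MN}F^2\bigr),\qquad d(*F^4)=0 .$$ In $11$-dimensional supergravity (with vanishing fermions) the second equation is replaced by $d(*F^4)=\pm\frac1{\sqrt2}F^4\wedge F^4$, the sign depending on the choice of orientation. Let $I_1=\{1,4,7\}$, $I_2=\{8,9,10\}$, $I_3=\{2,5,7\}$, $I_4=\{4,6,10\}$, $I_5=\{2,3,9\}$, $I_6=\{1,2,8\}$, $I_7=\{1,3,10\}$, $I_8=\{4,5,8\}$, $I_9=\{3,6,7\}$, $I_{10}=\{5,6,9\}$ be the brane sets of ten electric branes ($SM2$-branes), let $U^s=(\delta_{iI_s})_{i=1}^{10}$ ($\delta_{iI}=1$ if $i\in I$ and $0$ otherwise) be the brane co-vectors, and let $(U,V)=G^{ij}U_iV_j$,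 where $(G^{ij})$ is the inverse of the matrix $G_{ij}=\delta_{ij}-1$, $1\le i,j\le 10$. Let $A=(A_{ss'})$ be the $10\times10$ matrix $$A=\begin{pmatrix} 2&-1&0&0&-1&0&0&0&0&-1\\ -1&2&-1&0&0&0&0&0&-1&0\\ 0&-1&2&-1&0&0&-1&0&0&0\\ 0&0&-1&2&-1&-1&0&0&0&0\\ -1&0&0&-1&2&0&0&-1&0&0\\ 0&0&0&-1&0&2&0&0&-1&-1\\ 0&0&-1&0&0&0&2&-1&0&-1\\ 0&0&0&0&-1&0&-1&2&-1&0\\ 0&-1&0&0&0&-1&0&-1&2&0\\ -1&0&0&0&0&-1&-1&0&0&2\end{pmatrix}.$$ (1) $A$ is a non-degenerate generalized Cartan matrix of signature $(-,+,\dots,+)$, i.e. it defines a Lorentzian Kac--Moody algebra (denoted $P_{10}$), and its Dynkin diagram is the Petersen graph. (2) The branes obey the intersection rules of $P_{10}$: all $(U^s,U^s)=2$, $A_{ss'}=2(U^s,U^{s'})/(U^{s'},U^{s'})$ for all $s,s'$, and $|I_s\cap I_{s'}|=\frac{|I_s||I_{s'}|}{9}+A_{ss'}=1+A_{ss'}$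 for $s\ne s'$. The co-vectors $U^1,\dots,U^{10}$ are linearly independent. (3) Let $J\subseteq\mathbb R$ be an open interval, let $Q_1,\dots,Q_{10}$ be non-zero real numbers, and let smooth functions $q^s=q^s(t)$, $t\in J$, satisfy the Toda equations and the energy constraint $$\ddot q^s=-2Q_s^2\exp\Bigl(\sum_{s'=1}^{10}A_{ss'}q^{s'}\Bigr),\qquad E_T=\tfrac18\sum_{s,s'=1}^{10}A_{ss'}\dot q^s\dot q^{s'}+\tfrac12\sum_{s=1}^{10}Q_s^2\exp\Bigl(\sum_{s'=1}^{10}A_{ss'}q^{s'}\Bigr)=0 .$$ Put $f_s=\exp(-q^s)$. Then on $J\times\mathbb R^{10}$ the metric and the $4$-form $$g=\Bigl(\prod_{s=1}^{10}f_s\Bigr)^{1/3}\Bigl\{-dt\otimes dt+\sum_{i=1}^{10}\Bigl(\prod_{s:\,i\in I_s}f_s\Bigr)^{-1}dx^i\otimes dx^i\Bigr\},$$ $$F^4=\sum_{s=1}^{10}Q_s\Bigl(\prod_{s'=1}^{10}f_{s'}^{-A_{ss'}}\Bigr)dt\wedge dx^{i}\wedge dx^{j}\wedge dx^{k},\qquad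 I_s=\{i<j<k\},$$ are a smooth solution of the equations of the $B_{11}$-model. Moreover $F^4\wedge F^4=0$, and $(g,F^4)$ is also a solution of the equations of $11$-dimensional supergravity. (4) One has $b_s=2\sum_{s'}(A^{-1})_{ss'}=-2$ for all $s$. Let $Q\ne0$, $t_0\in\mathbb R$ and let all charges be equal up to sign, $Q_s^2=Q^2$. Then $f_s=\bar f^{\,-2}$ for all $s$, with $\bar f(t)=|Q|(t-t_0)$, $t>t_0$, is a solution of this kind: $q^s=2\ln\bar f$ satisfies the Toda equations with $E_T=0$, and the corresponding $(g,F^4)$ solves the equations of the $B_{11}$-model and of $11$-dimensional supergravity. There are a constant $A_*>0$, depending only on $Q$, and a smooth change of the time variable $t\mapsto t_s$ from $(t_0,\infty)$ onto $(0,\infty)$ with nowhere vanishing derivative such that $$g=-dt_s\otimes dt_s+A_*\,t_s^{2/7}\sum_{i=1}^{10}dx^i\otimes dx^i .$$ -/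

import Mathlib

open scoped ContDiff

noncomputable section

namespace PetersenSBrane

/-! ## Cartan matrices and the Petersen graph

A Kac-Moody algebra is given by its generalized Cartan matrix; it is called Lorentzian when
this matrix has signature `(-,+,…,+)`. -/

/-- A generalized Cartan matrix: `A i i = 2`, the off-diagonal entries are non-positive integers,
and `A i j = 0` implies `A j i = 0`. -/
structure IsGeneralizedCartanMatrix {ι : Type*} (A : Matrix ι ι ℤ) : Prop where
  diag : ∀ i, A i i = 2
  nonpos : ∀ i j, i ≠ j → A i j ≤ 0
  zero_symm : ∀ i j, A i j = 0 → A j i = 0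

/-- A symmetric real matrix of signature `(-,+,…,+)`. -/
structure IsLorentzian {n : ℕ} (M : Matrix (Fin (n + 1)) (Fin (n + 1)) ℝ) : Prop where
  symm : M.IsSymm
  sigNeg_eq : sigNeg M.toQuadraticForm' = 1
  sigPos_eq : sigPos M.toQuadraticForm' = n

/-- The Cartan matrix of the Kac-Moody algebra `P₁₀`; the node written `s` here (counted from `0`)
is the node usually numbered `s + 1`. -/
def cartanP10 : Matrix (Fin 10) (Fin 10) ℤ :=
  !![ 2, -1,  0,  0, -1,  0,  0,  0,  0, -1;
     -1,  2, -1,  0,  0,  0,  0,  0, -1,  0;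
      0, -1,  2, -1,  0,  0, -1,  0,  0,  0;
      0,  0, -1,  2, -1, -1,  0,  0,  0,  0;
     -1,  0,  0, -1,  2,  0,  0, -1,  0,  0;
      0,  0,  0, -1,  0,  2,  0,  0, -1, -1;
      0,  0, -1,  0,  0,  0,  2, -1,  0, -1;
      0,  0,  0,  0, -1,  0, -1,  2, -1,  0;
      0, -1,  0,  0,  0, -1,  0, -1,  2,  0;
     -1,  0,  0,  0,  0, -1, -1,  0,  0,  2]

/-- The same matrix with real entries. -/
def cartanP10Real : Matrix (Fin 10) (Fin 10) ℝ := cartanP10.map (fun z : ℤ => (z : ℝ))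

/-- The graph underlying the Dynkin diagram of a generalized Cartan matrix: two different nodes
are joined when the corresponding entry is non-zero. -/
def dynkinGraph {ι : Type*} (A : Matrix ι ι ℤ) : SimpleGraph ι :=
  SimpleGraph.fromRel (fun i j => A i j ≠ 0)

/-- The Petersen graph: the vertices are the two-element subsets of a five-element set, and two
vertices are joined when they are disjoint. -/
def petersenGraph : SimpleGraph {v : Finset (Fin 5) // v.card = 2} where
  Adj v w := Disjoint v.1 w.1
  symm := ⟨fun _ _ h => h.symm⟩
  loopless := ⟨fun v h => by
    have h0 : v.1 = ∅ := by simpa using h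
    have h2 := v.2
    rw [h0] at h2
    simp at h2⟩

/-! ## The branes

Space-time coordinates are numbered by `Fin 11`: `0` is the time `t`, and `1, …, 10` are
the spatial coordinates `x¹, …, x¹⁰`. -/

/-- The three spatial directions of each of the ten branes, in increasing order. -/
def braneDir : Fin 10 → Fin 3 → Fin 11 :=
  ![![1, 4, 7], ![8, 9, 10], ![2, 5, 7], ![4, 6, 10], ![2, 3, 9],
    ![1, 2, 8], ![1, 3, 10], ![4, 5, 8], ![3, 6, 7], ![5, 6, 9]]

/-- The brane set `I_s`. -/
def braneSet (s : Fin 10) : Finset (Fin 11) := Finset.univ.image (braneDir s)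

/-- The brane co-vector `U^s`, with components `δ_{i I_s}` (all factor spaces are
one-dimensional and there are no scalar fields); the entry `i : Fin 10` belongs to `x^{i+1}`. -/
def braneCovector (s : Fin 10) : Fin 10 → ℝ := fun i => if i.succ ∈ braneSet s then 1 else 0

/-- The minisupermetric `G_{ij} = d_i δ_{ij} - d_i d_j` for ten one-dimensional factor spaces. -/
def minisuperMetric : Matrix (Fin 10) (Fin 10) ℝ :=
  Matrix.of fun i j => (if i = j then 1 else 0) - 1

/-- The scalar product `(U, V) = G^{ij} U_i V_j` of co-vectors, `(G^{ij})` being the inverse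
of the minisupermetric. -/
def covectorProduct (U V : Fin 10 → ℝ) : ℝ := U ⬝ᵥ (minisuperMetric⁻¹).mulVec V

/-- The ten electric branes with brane sets `I_s` (each of world-volume dimension
`d(I_s) = 4 - 1 = 3`) obey the intersection rules of the Kac-Moody algebra with generalized Cartan
matrix `A`: one has `A_{ss'} = 2 (U^s,U^{s'}) / (U^{s'},U^{s'})` with all `(U^s,U^s) ≠ 0`, and
`d(I_s ∩ I_{s'}) = d(I_s) d(I_{s'}) / (D - 2) + (1/2) (U^{s'},U^{s'}) A_{ss'}`
for `s ≠ s'`, with `D = 11`. -/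
structure ObeysIntersectionRules (A : Matrix (Fin 10) (Fin 10) ℤ) : Prop where
  spatial : ∀ s, 0 ∉ braneSet s
  card_eq : ∀ s, (braneSet s).card = 3
  norm_ne_zero : ∀ s, covectorProduct (braneCovector s) (braneCovector s) ≠ 0
  cartan_eq : ∀ s s', (A s s' : ℝ) =
    2 * covectorProduct (braneCovector s) (braneCovector s') /
      covectorProduct (braneCovector s') (braneCovector s')
  card_inter : ∀ s s', s ≠ s' → ((braneSet s ∩ braneSet s').card : ℝ) =
    ((braneSet s).card : ℝ) * ((braneSet s').card : ℝ) / (11 - 2) +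
      1 / 2 * covectorProduct (braneCovector s') (braneCovector s') * (A s s' : ℝ)

/-! ## Tensors in coordinates -/

/-- The partial derivative `∂_i f`. -/
def partialDeriv {n : ℕ} (i : Fin n) (f : (Fin n → ℝ) → ℝ) (x : Fin n → ℝ) : ℝ :=
  fderiv ℝ f x (Pi.single i 1)

/-- The Christoffel symbol `Γ^k_{ij}` of the metric `g`. -/
def christoffel {n : ℕ} (g : (Fin n → ℝ) → Matrix (Fin n) (Fin n) ℝ) (k i j : Fin n)
    (x : Fin n → ℝ) : ℝ :=
  1 / 2 * ∑ l, (g x)⁻¹ k l *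
    (partialDeriv i (fun y => g y l j) x + partialDeriv j (fun y => g y l i) x
      - partialDeriv l (fun y => g y i j) x)

/-- The Ricci tensor
`R_{ij} = ∂_k Γ^k_{ij} - ∂_j Γ^k_{ik} + Γ^k_{kl} Γ^l_{ij} - Γ^k_{jl} Γ^l_{ik}`. -/
def ricci {n : ℕ} (g : (Fin n → ℝ) → Matrix (Fin n) (Fin n) ℝ) (i j : Fin n)
    (x : Fin n → ℝ) : ℝ :=
  ∑ k, (partialDeriv k (christoffel g k i j) x - partialDeriv j (christoffel g k i k) x) +
    ∑ k, ∑ l, (christoffel g k k l x * christoffel g l i j x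
      - christoffel g k j l x * christoffel g l i k x)

/-- The scalar curvature `R = g^{ij} R_{ij}`. -/
def scalarCurvature {n : ℕ} (g : (Fin n → ℝ) → Matrix (Fin n) (Fin n) ℝ) (x : Fin n → ℝ) : ℝ :=
  ∑ i, ∑ j, (g x)⁻¹ i j * ricci g i j x

/-- The pull-back `ψ^* h` of the metric `h` under the map `ψ`. -/
def pullbackMetric {n : ℕ} (ψ : (Fin n → ℝ) → (Fin n → ℝ))
    (h : (Fin n → ℝ) → Matrix (Fin n) (Fin n) ℝ) (x : Fin n → ℝ) : Matrix (Fin n) (Fin n) ℝ :=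
  Matrix.of fun i j => ∑ k, ∑ l,
    partialDeriv i (fun y => ψ y k) x * partialDeriv j (fun y => ψ y l) x * h (ψ x) k l

/-- The component `F_{M_1 … M_p}` of a `p`-covector. -/
def formComp {n p : ℕ} (F : (Fin n → ℝ) [⋀^Fin p]→L[ℝ] ℝ) (M : Fin p → Fin n) : ℝ :=
  F (fun a => Pi.single (M a) 1)

/-- The component `F^{M_1 … M_p}`, the indices being raised with the metric `g`. -/
def upComp {n p : ℕ} (g : Matrix (Fin n) (Fin n) ℝ) (F : (Fin n → ℝ) [⋀^Fin p]→L[ℝ] ℝ)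
    (M : Fin p → Fin n) : ℝ :=
  ∑ N : Fin p → Fin n, (∏ a, g⁻¹ (M a) (N a)) * formComp F N

/-- The elementary covector `dx^{I_1} ∧ ⋯ ∧ dx^{I_p}`,
with value `det (v_a^{I_b})` on the vectors `v_1, …, v_p`. -/
def coordForm {n p : ℕ} (I : Fin p → Fin n) : (Fin n → ℝ) [⋀^Fin p]→L[ℝ] ℝ :=
  { (Matrix.detRowAlternating (R := ℝ) (n := Fin p)).compLinearMap
      (LinearMap.funLeft ℝ ℝ I) with
    cont := by
      change Continuous fun v : Fin p → Fin n → ℝ => Matrix.det (fun a b => v a (I b))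
      fun_prop }

/-- The exterior product of two covectors, as a sum over shuffles. -/
def wedge {n p q : ℕ} (F : (Fin n → ℝ) [⋀^Fin p]→L[ℝ] ℝ) (G : (Fin n → ℝ) [⋀^Fin q]→L[ℝ] ℝ) :
    (Fin n → ℝ) [⋀^Fin p ⊕ Fin q]→ₗ[ℝ] ℝ :=
  (LinearMap.mul' ℝ ℝ).compAlternatingMap (F.toAlternatingMap.domCoprod G.toAlternatingMap)

/-- The Levi-Civita symbol `ε^{N P}` with the index tuples `N` (length 3) and `P` (length 4 + 4),
normalized by `ε^{0 1 … 10} = 1`. -/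
def leviCivita (N : Fin 3 → Fin 11) (P : Fin 4 ⊕ Fin 4 → Fin 11) : ℝ :=
  Matrix.det (Matrix.of fun a b : Fin 11 =>
    if (Fin.append N (Fin.append (P ∘ Sum.inl) (P ∘ Sum.inr)) : Fin (3 + (4 + 4)) → Fin 11) a = b
    then (1 : ℝ) else 0)

/-! ## The field equations -/

/-- `F² = F_{MNPQ} F^{MNPQ}`. -/
def formSq (g : Matrix (Fin 11) (Fin 11) ℝ) (F : (Fin 11 → ℝ) [⋀^Fin 4]→L[ℝ] ℝ) : ℝ :=
  ∑ M : Fin 4 → Fin 11, formComp F M * upComp g F M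

/-- `F_{M P Q R} F_N^{P Q R}`. -/
def formContraction (g : Matrix (Fin 11) (Fin 11) ℝ) (F : (Fin 11 → ℝ) [⋀^Fin 4]→L[ℝ] ℝ)
    (M N : Fin 11) : ℝ :=
  ∑ P : Fin 3 → Fin 11, ∑ Q : Fin 3 → Fin 11,
    (∏ a, g⁻¹ (P a) (Q a)) * formComp F (Fin.cons M P) * formComp F (Fin.cons N Q)

/-- `(g, F)` is a smooth solution on the open set `U`, with potential `A`, of the equations of
motion of the action
`∫ √|g| (R[g] - (1/4!) F²) d¹¹z + (Chern-Simons term) ∫ A ∧ F ∧ F`, with `F = dA`. These are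
`R_{MN} - (1/2) g_{MN} R = (1/4!) (4 F_{MPQR} F_N^{PQR} - (1/2) g_{MN} F²)` and
`∂_M (√|g| F^{MNPQ}) = (c / 8!) ε^{N P Q K_1 … K_8} (F ∧ F)_{K_1 … K_8}`,
the latter being the coordinate form of `d * F = c F ∧ F` (up to orientation); the coefficient of
the Chern-Simons term is proportional to `c`. The metric has signature `(-,+,…,+)`. -/
structure SolvesFieldEquations (c : ℝ) (U : Set (Fin 11 → ℝ))
    (g : (Fin 11 → ℝ) → Matrix (Fin 11) (Fin 11) ℝ)
    (F : (Fin 11 → ℝ) → (Fin 11 → ℝ) [⋀^Fin 4]→L[ℝ] ℝ) : Prop where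
  smooth_metric : ∀ i j, ContDiffOn ℝ ∞ (fun x => g x i j) U
  lorentzian : ∀ x ∈ U, IsLorentzian (g x)
  smooth_form : ContDiffOn ℝ ∞ F U
  potential : ∃ A : (Fin 11 → ℝ) → (Fin 11 → ℝ) [⋀^Fin 3]→L[ℝ] ℝ,
    ContDiffOn ℝ ∞ A U ∧ ∀ x ∈ U, extDeriv A x = F x
  einstein : ∀ x ∈ U, ∀ M N,
    ricci g M N x - 1 / 2 * g x M N * scalarCurvature g x =
      1 / 24 * (4 * formContraction (g x) (F x) M N - 1 / 2 * g x M N * formSq (g x) (F x))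
  maxwell : ∀ x ∈ U, ∀ N : Fin 3 → Fin 11,
    ∑ M, partialDeriv M (fun y => √|(g y).det| * upComp (g y) (F y) (Fin.cons M N)) x =
      c / (Nat.factorial 8 : ℝ) *
        ∑ K : Fin 4 ⊕ Fin 4 → Fin 11,
          leviCivita N K * wedge (F x) (F x) (fun a => Pi.single (K a) 1)

/-- Solutions of the `B₁₁`-model, i.e. of 11-dimensional supergravity truncated by leaving out the
Chern-Simons term. -/
def SolvesB11 (U : Set (Fin 11 → ℝ)) (g : (Fin 11 → ℝ) → Matrix (Fin 11) (Fin 11) ℝ)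
    (F : (Fin 11 → ℝ) → (Fin 11 → ℝ) [⋀^Fin 4]→L[ℝ] ℝ) : Prop :=
  SolvesFieldEquations 0 U g F

/-- Solutions (with vanishing fermions) of 11-dimensional supergravity. In the standard
normalization the bosonic action is `∫ R * 1 - (1/2) G ∧ * G - (1/6) C ∧ G ∧ G` with `G = dC`, and
`d * G + (1/2) G ∧ G = 0`; with `G = √2 F` this gives the kinetic term `- (1/4!) F²`
and `d * F = ∓ (1/√2) F ∧ F`. The sign depends on the choice of the orientation, and both
signs are required here. -/
def SolvesSupergravity (U : Set (Fin 11 → ℝ)) (g : (Fin 11 → ℝ) → Matrix (Fin 11) (Fin 11) ℝ)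
    (F : (Fin 11 → ℝ) → (Fin 11 → ℝ) [⋀^Fin 4]→L[ℝ] ℝ) : Prop :=
  SolvesFieldEquations (1 / √2) U g F ∧ SolvesFieldEquations (-(1 / √2)) U g F

/-! ## The Toda chain and the brane configuration -/

/-- The Toda-type equations `q̈^s = - 2 Q_s² exp (∑_{s'} A_{ss'} q^{s'})` of `P₁₀` on the interval
`J`, for smooth functions `q^s`. -/
structure SolvesToda (J : Set ℝ) (Q : Fin 10 → ℝ) (q : Fin 10 → ℝ → ℝ) : Prop where
  smooth : ∀ s, ContDiffOn ℝ ∞ (q s) J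
  eqn : ∀ s, ∀ t ∈ J, deriv (deriv (q s)) t =
    -2 * Q s ^ 2 * Real.exp (∑ s', cartanP10Real s s' * q s' t)

/-- The energy `E_T` of the Toda chain at time `t`. -/
def todaEnergy (Q : Fin 10 → ℝ) (q : Fin 10 → ℝ → ℝ) (t : ℝ) : ℝ :=
  1 / 8 * ∑ s, ∑ s', cartanP10Real s s' * deriv (q s) t * deriv (q s') t +
    1 / 2 * ∑ s, Q s ^ 2 * Real.exp (∑ s', cartanP10Real s s' * q s' t)

/-- `f_s = exp (- q^s)`. -/
def fFun (q : Fin 10 → ℝ → ℝ) (s : Fin 10) (t : ℝ) : ℝ := Real.exp (-(q s t))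

/-- The space-time region `{(t, x) | t ∈ J}`. -/
def slab (J : Set ℝ) : Set (Fin 11 → ℝ) := {x | x 0 ∈ J}

/-- The metric
`(∏_s f_s)^{1/3} { - dt ⊗ dt + ∑_i (∏_{s : i ∈ I_s} f_s)⁻¹ dx^i ⊗ dx^i }`, where `f_s = f_s(t)`. -/
def braneMetric (q : Fin 10 → ℝ → ℝ) (x : Fin 11 → ℝ) : Matrix (Fin 11) (Fin 11) ℝ :=
  (∏ s, fFun q s (x 0)) ^ (1 / 3 : ℝ) •
    Matrix.diagonal fun i : Fin 11 =>
      if i = 0 then -1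
      else (∏ s with i ∈ braneSet s, fFun q s (x 0))⁻¹

/-- The 4-form `∑_s Q_s (∏_{s'} f_{s'}^{- A_{ss'}}) dt ∧ τ(I_s)`. -/
def braneForm (Q : Fin 10 → ℝ) (q : Fin 10 → ℝ → ℝ) (x : Fin 11 → ℝ) :
    (Fin 11 → ℝ) [⋀^Fin 4]→L[ℝ] ℝ :=
  ∑ s, (Q s * ∏ s', fFun q s' (x 0) ^ (-(cartanP10 s s'))) •
    coordForm (Fin.cons 0 (braneDir s) : Fin 4 → Fin 11)

/-- The functions `q^s` of the special solution, for which `f_s = (|Q| (t - t₀))⁻²`. -/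
def specialQ (Q t₀ : ℝ) : Fin 10 → ℝ → ℝ := fun _ t => 2 * Real.log (|Q| * (t - t₀))

/-- The power-law metric `- dt ⊗ dt + a t^{2/7} ∑_i dx^i ⊗ dx^i`. -/
def powerLawMetric (a : ℝ) (x : Fin 11 → ℝ) : Matrix (Fin 11) (Fin 11) ℝ :=
  Matrix.diagonal fun i : Fin 11 => if i = 0 then -1 else a * x 0 ^ (2 / 7 : ℝ)

end PetersenSBrane

end

open PetersenSBrane

open PetersenSBrane

namespace PetersenSBrane
open Matrix

/-! ## The Cartan matrix and the branes -/

/-! Write `A = 2 - P` with `P` the adjacency matrix of the Petersen graph. The graph is strongly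
regular with parameters `(10, 3, 0, 1)`, so `A² = 5A - 4 + J` with `J` the all-ones matrix, and
every row of `A` sums to `-1`. Hence `A` has eigenvalue `-1` on the constants, and its eigenvalues
on sum-zero vectors are roots of `λ² - 5λ + 4`, i.e. `1` or `4`: the signature is Lorentzian. The
brane sets satisfy `|I_s ∩ I_{s'}| = 1 + A_{ss'}` (also for `s = s'`), and the inverse
minisupermetric is `δ - 1/9`, so `A` is the Gram matrix of the co-vectors.

For the field equations, write the metric coefficients as `± exp (2γ_i)` with `γ_i` linear in the
`q^s` (`logCoeff`). The time is harmonic: the spatial `γ_a` sum to `γ_0` (`sum_logCoeff_succ`). So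
the spatial Ricci components contain only `γ_a''`, which the Toda equations express by the potential
terms, while in `R_00` the remaining quadratic form in the velocities is eliminated by `E_T = 0`.
Two different index sets `{0} ∪ I_s` share at most two elements, so no cross terms appear in the
stress tensor, which is diagonal (`formContraction_sum_coordForm_self`).

The densitized raised components of the form are the constants `∓Q_s` (`sqrt_abs_det_mul_upComp`),
which gives the Maxwell equation. Every term of the form contains `dt`, so its wedge square vanishes
and the Chern-Simons coefficient plays no role. A potential is `-∑ (q̇^s / 2Q_s) dx^{I_s}`.

For equal charges the row sums `-1` decouple the Toda chain, and an integration of `√(-g_00)` gives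
the synchronous time. -/

/-- A symmetric matrix which is positive definite on a hyperplane and negative on some vector
is Lorentzian. -/
theorem IsLorentzian.of_hyperplane {n : ℕ} {M : Matrix (Fin (n + 1)) (Fin (n + 1)) ℝ}
    (hM : M.IsSymm) (u : Fin (n + 1) → ℝ) (hu : u ⬝ᵥ M *ᵥ u < 0)
    (φ : (Fin (n + 1) → ℝ) →ₗ[ℝ] ℝ)
    (hφ : ∀ x, x ≠ 0 → φ x = 0 → 0 < x ⬝ᵥ M *ᵥ x) : IsLorentzian M := by
  have hq : ∀ x, M.toQuadraticForm' x = x ⬝ᵥ M *ᵥ x := fun x => by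
    simp [Matrix.toQuadraticForm', toLinearMap₂'_apply']
  have hpos : n ≤ sigPos M.toQuadraticForm' := by
    have h1 := le_sigPos_of_posDef (Q := M.toQuadraticForm') (V := LinearMap.ker φ)
      (by
        intro x hx
        simpa [hq] using hφ x (by simpa using hx) x.2)
    have h2 := LinearMap.finrank_range_add_finrank_ker φ
    have h3 := Submodule.finrank_le (LinearMap.range φ)
    simp at h2 h3
    omega
  have hneg : 1 ≤ sigNeg M.toQuadraticForm' := by
    have hu0 : u ≠ 0 := by rintro rfl; simp at hu
    refine (finrank_span_singleton (K := ℝ) hu0).symm.le.trans (le_sigNeg_of_negDef _ ?_)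
    rintro ⟨x, hx⟩ hx0
    obtain ⟨c, rfl⟩ := Submodule.mem_span_singleton.1 hx
    have hc : c ≠ 0 := by rintro rfl; simp at hx0
    have hc2 : 0 < c * c := mul_self_pos.2 hc
    have : 0 < -(c * c * (u ⬝ᵥ M *ᵥ u)) := by nlinarith
    simpa [hq, mulVec_smul, mul_assoc] using this
  -- The two indices and the dimension of the radical add up to `n + 1`, so both lower bounds are
  -- sharp.
  have hsum := QuadraticForm.sigPos_add_sigNeg_add_radical (Q := M.toQuadraticForm')
  simp at hsum
  exact ⟨hM, by omega, by omega⟩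

theorem isLorentzian_diagonal {n : ℕ} {d : Fin (n + 1) → ℝ} (h0 : d 0 < 0)
    (h : ∀ i, i ≠ 0 → 0 < d i) : IsLorentzian (diagonal d) := by
  refine IsLorentzian.of_hyperplane (isSymm_diagonal d) (Pi.single 0 1) (by simpa [mulVec_diagonal] using h0)
    (LinearMap.proj 0) fun x hx hx0 => ?_
  simp only [LinearMap.coe_proj, Function.eval] at hx0
  obtain ⟨i, hi⟩ := Function.ne_iff.1 hx
  simp only [dotProduct, mulVec_diagonal]
  have hterm : ∀ j, 0 ≤ x j * (d j * x j) := fun j => by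
    by_cases hj : j = 0
    · simp [hj, hx0]
    · have := h j hj
      nlinarith [mul_nonneg this.le (mul_self_nonneg (x j))]
  refine Finset.sum_pos' (fun j _ => hterm j) ⟨i, Finset.mem_univ _, ?_⟩
  have hi0 : i ≠ 0 := by rintro rfl; exact hi hx0
  have := mul_pos (h i hi0) (mul_self_pos.2 hi)
  linarith

/-- Strong regularity of the Petersen graph: adjacent vertices have no common neighbour, distinct
non-adjacent ones exactly one. -/
theorem cartanP10_mul_self :
    cartanP10 * cartanP10 = 5 • cartanP10 - 4 • 1 + Matrix.of fun _ _ => 1 := by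
  decide +kernel

theorem cartanP10_row_sum (s : Fin 10) : ∑ s', cartanP10 s s' = -1 := by
  revert s; decide +kernel

theorem cartanP10_symm (s s' : Fin 10) : cartanP10 s s' = cartanP10 s' s := by
  have h : ∀ p : Fin 10 × Fin 10, cartanP10 p.1 p.2 = cartanP10 p.2 p.1 := by decide +kernel
  exact h (s, s')

theorem isGeneralizedCartanMatrix_cartanP10 : IsGeneralizedCartanMatrix cartanP10 :=
  ⟨by decide +kernel,
    fun i j => (by decide +kernel :
      ∀ p : Fin 10 × Fin 10, p.1 ≠ p.2 → cartanP10 p.1 p.2 ≤ 0) (i, j),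
    fun i j h => by rw [cartanP10_symm, h]⟩

/-- Since `A J = -J`, the quadratic relation for `A` displays an inverse up to the factor `-4`. -/
theorem cartanP10_mul_adjugate :
    cartanP10 * (cartanP10 - 5 • 1 + Matrix.of fun _ _ => 1) = (-4 : ℤ) • 1 := by
  decide +kernel

theorem det_cartanP10_ne_zero : cartanP10.det ≠ 0 := by
  intro h
  have := congrArg det cartanP10_mul_adjugate
  rw [det_mul, h, det_smul] at this
  simp at this

theorem cartanP10Real_apply (s s' : Fin 10) : cartanP10Real s s' = (cartanP10 s s' : ℝ) := rfl

theorem cartanP10Real_row_sum (s : Fin 10) : ∑ s', cartanP10Real s s' = -1 := by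
  have := cartanP10_row_sum s
  simp only [cartanP10Real_apply]
  exact_mod_cast this

theorem isUnit_cartanP10Real : IsUnit cartanP10Real.det := by
  have : cartanP10Real.det = (cartanP10.det : ℝ) := by
    simp [cartanP10Real, Int.cast_det]
  rw [this, isUnit_iff_ne_zero]
  exact_mod_cast det_cartanP10_ne_zero

theorem cartanP10Real_inv_row_sum (s : Fin 10) : ∑ s', cartanP10Real⁻¹ s s' = -1 := by
  have h1 : cartanP10Real *ᵥ 1 = -1 := by
    ext s; simpa [mulVec, dotProduct] using cartanP10Real_row_sum s
  have h2 : cartanP10Real⁻¹ *ᵥ 1 = -1 := by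
    have := congrArg (cartanP10Real⁻¹ *ᵥ ·) h1
    simp only [mulVec_mulVec, nonsing_inv_mul _ isUnit_cartanP10Real, one_mulVec, mulVec_neg] at this
    simpa using (congrArg (-·) this).symm
  simpa [mulVec, dotProduct] using congrFun h2 s

theorem isSymm_cartanP10Real : cartanP10Real.IsSymm := by
  ext s s'
  simp [cartanP10Real_apply, cartanP10_symm s' s]

theorem cartanP10Real_mul_self :
    cartanP10Real * cartanP10Real = (5 : ℝ) • cartanP10Real - (4 : ℝ) • 1 + Matrix.of fun _ _ => 1 := by
  ext s s'
  have := congrFun (congrFun cartanP10_mul_self s) s'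
  simp only [Matrix.mul_apply, Matrix.add_apply, Matrix.sub_apply, Matrix.smul_apply, of_apply,
    Matrix.one_apply] at this ⊢
  have h := congrArg (fun z : ℤ => (z : ℝ)) this
  simp only [cartanP10Real_apply]
  push_cast at h
  rw [h]
  simp

theorem isLorentzian_cartanP10Real : IsLorentzian cartanP10Real := by
  have h1 : cartanP10Real *ᵥ 1 = -1 := by
    ext s; simpa [mulVec, dotProduct] using cartanP10Real_row_sum s
  refine IsLorentzian.of_hyperplane isSymm_cartanP10Real 1 (by simp [h1])
    (∑ i, LinearMap.proj i) fun x hx hx0 => ?_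
  replace hx0 : ∑ i, x i = 0 := by simpa using hx0
  set y := cartanP10Real *ᵥ x with hy
  have hyy : y ⬝ᵥ y = 5 * (x ⬝ᵥ y) - 4 * (x ⬝ᵥ x) := by
    have hJ : (Matrix.of fun _ _ => (1 : ℝ) : Matrix (Fin 10) (Fin 10) ℝ) *ᵥ x = 0 := by
      ext i; simp [mulVec, dotProduct, hx0]
    have : y ⬝ᵥ y = x ⬝ᵥ (cartanP10Real * cartanP10Real) *ᵥ x := by
      rw [← mulVec_mulVec, ← hy, dotProduct_mulVec, ← mulVec_transpose, isSymm_cartanP10Real.eq, dotProduct_comm]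
    rw [this, cartanP10Real_mul_self, add_mulVec, hJ, sub_mulVec, smul_mulVec, smul_mulVec, one_mulVec]
    simp [dotProduct_sub, hy]
  -- On the hyperplane `(A - 1)² = 3 (A - 1)`, since the eigenvalues there are `1` and `4`.
  -- Non-negativity of this square gives `x ⬝ᵥ A x ≥ x ⬝ᵥ x` without any diagonalization.
  have h3 : (y - x) ⬝ᵥ (y - x) = 3 * (x ⬝ᵥ y) - 3 * (x ⬝ᵥ x) := by
    rw [sub_dotProduct, dotProduct_sub, dotProduct_sub, dotProduct_comm y x, hyy]; ring
  have h4 : 0 ≤ (y - x) ⬝ᵥ (y - x) := by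
    simp only [dotProduct]; exact Finset.sum_nonneg fun i _ => mul_self_nonneg _
  have h5 : 0 < x ⬝ᵥ x := lt_of_le_of_ne
    (by simp only [dotProduct]; exact Finset.sum_nonneg fun i _ => mul_self_nonneg _)
    (fun h => hx (dotProduct_self_eq_zero.1 h.symm))
  linarith

theorem nonempty_dynkinGraph_iso_petersenGraph :
    Nonempty (dynkinGraph cartanP10 ≃g petersenGraph) := by
  -- A labelling of the nodes by two-element subsets, with linked nodes receiving disjoint subsets.
  let f : Fin 10 → {v : Finset (Fin 5) // v.card = 2} :=
    ![⟨{0, 1}, rfl⟩, ⟨{2, 3}, rfl⟩, ⟨{0, 4}, rfl⟩, ⟨{1, 2}, rfl⟩, ⟨{3, 4}, rfl⟩,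
      ⟨{0, 3}, rfl⟩, ⟨{1, 3}, rfl⟩, ⟨{0, 2}, rfl⟩, ⟨{1, 4}, rfl⟩, ⟨{2, 4}, rfl⟩]
  have hinj : Function.Injective f := by
    have h : ∀ p : Fin 10 × Fin 10, f p.1 = f p.2 → p.1 = p.2 := by decide +kernel
    exact fun a b hab => h (a, b) hab
  have hcard : Fintype.card (Fin 10) = Fintype.card {v : Finset (Fin 5) // v.card = 2} := by
    simp [Fintype.card_subtype, Finset.card_powersetCard,
      Nat.choose]
  have hbij := (Fintype.bijective_iff_injective_and_card f).2 ⟨hinj, hcard⟩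
  refine ⟨⟨Equiv.ofBijective f hbij, fun {a b} => ?_⟩⟩
  have h : ∀ p : Fin 10 × Fin 10, Disjoint (f p.1).1 (f p.2).1 ↔
      (p.1 ≠ p.2 ∧ (cartanP10 p.1 p.2 ≠ 0 ∨ cartanP10 p.2 p.1 ≠ 0)) := by decide +kernel
  exact h (a, b)

/-! ### Intersection numbers and scalar products of the branes -/

theorem card_braneSet (s : Fin 10) : (braneSet s).card = 3 := by
  revert s; decide +kernel

theorem zero_notMem_braneSet (s : Fin 10) : 0 ∉ braneSet s := by
  revert s; decide +kernel

theorem card_braneSet_inter (s s' : Fin 10) :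
    ((braneSet s ∩ braneSet s').card : ℤ) = 1 + cartanP10 s s' := by
  have h : ∀ p : Fin 10 × Fin 10,
    ((braneSet p.1 ∩ braneSet p.2).card : ℤ) = 1 + cartanP10 p.1 p.2 := by decide +kernel
  exact h (s, s')

theorem card_braneSet_inter_real (s s' : Fin 10) :
    ((braneSet s ∩ braneSet s').card : ℝ) = 1 + cartanP10Real s s' := by
  rw [cartanP10Real_apply]; exact_mod_cast card_braneSet_inter s s'

theorem minisuperMetric_inv :
    minisuperMetric⁻¹ = Matrix.of fun i j => (if i = j then 1 else 0) - 1 / 9 := by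
  apply Matrix.inv_eq_left_inv
  ext i j
  simp only [Matrix.mul_apply, minisuperMetric, of_apply, sub_mul, mul_sub, Finset.sum_sub_distrib,
    Matrix.one_apply]
  simp
  ring

theorem covectorProduct_eq (U V : Fin 10 → ℝ) :
    covectorProduct U V = ∑ i, U i * V i - 1 / 9 * (∑ i, U i) * ∑ i, V i := by
  have : (minisuperMetric⁻¹) *ᵥ V = fun i => V i - 1 / 9 * ∑ j, V j := by
    ext i
    simp [minisuperMetric_inv, mulVec, dotProduct, sub_mul, Finset.sum_sub_distrib,
      Finset.mul_sum]
  simp only [covectorProduct, this, dotProduct, mul_sub, Finset.sum_sub_distrib]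
  congr 1
  rw [← Finset.sum_mul]
  ring

theorem sum_succ_mem (S : Finset (Fin 11)) (hS : 0 ∉ S) :
    ∑ i : Fin 10, (if i.succ ∈ S then (1 : ℝ) else 0) = S.card := by
  have h := Fin.sum_univ_succ fun i : Fin 11 => if i ∈ S then (1 : ℝ) else 0
  rw [if_neg hS, zero_add] at h
  rw [← h]
  simp

theorem sum_braneCovector (s : Fin 10) : ∑ i, braneCovector s i = 3 := by
  simp only [braneCovector]
  rw [sum_succ_mem _ (zero_notMem_braneSet s), card_braneSet]
  norm_num

theorem sum_braneCovector_mul (s s' : Fin 10) :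
    ∑ i, braneCovector s i * braneCovector s' i = 1 + cartanP10Real s s' := by
  rw [← card_braneSet_inter_real, ← sum_succ_mem _ (by simp [zero_notMem_braneSet])]
  refine Finset.sum_congr rfl fun i _ => ?_
  simp only [braneCovector, Finset.mem_inter]
  split_ifs <;> simp_all

theorem covectorProduct_braneCovector (s s' : Fin 10) :
    covectorProduct (braneCovector s) (braneCovector s') = cartanP10Real s s' := by
  rw [covectorProduct_eq, sum_braneCovector_mul, sum_braneCovector, sum_braneCovector]
  ring

theorem covectorProduct_braneCovector_self (s : Fin 10) :
    covectorProduct (braneCovector s) (braneCovector s) = 2 := by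
  rw [covectorProduct_braneCovector, cartanP10Real_apply,
    isGeneralizedCartanMatrix_cartanP10.diag]
  norm_num

theorem obeysIntersectionRules : ObeysIntersectionRules cartanP10 where
  spatial := zero_notMem_braneSet
  card_eq := card_braneSet
  norm_ne_zero s := by rw [covectorProduct_braneCovector_self]; norm_num
  cartan_eq s s' := by
    rw [covectorProduct_braneCovector_self, covectorProduct_braneCovector, cartanP10Real_apply]
    ring
  card_inter s s' _ := by
    rw [card_braneSet_inter_real, card_braneSet, card_braneSet, covectorProduct_braneCovector_self,
      cartanP10Real_apply]
    norm_num

/-- The Gram matrix of the co-vectors is `A`, which is invertible. -/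
theorem linearIndependent_braneCovector : LinearIndependent ℝ braneCovector := by
  rw [Fintype.linearIndependent_iff]
  intro c hc
  have h : cartanP10Real *ᵥ c = 0 := by
    ext s
    have h1 : ∑ s', c s' * covectorProduct (braneCovector s) (braneCovector s') =
        covectorProduct (braneCovector s) (∑ s', c s' • braneCovector s') := by
      simp only [covectorProduct, mulVec_sum, dotProduct_sum, mulVec_smul, dotProduct_smul,
        smul_eq_mul]
    rw [hc] at h1
    simp only [covectorProduct_braneCovector] at h1
    simp only [mulVec, dotProduct, Pi.zero_apply]
    simpa [covectorProduct, mul_comm] using h1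
  have := congrArg (cartanP10Real⁻¹ *ᵥ ·) h
  simp only [mulVec_mulVec, nonsing_inv_mul _ isUnit_cartanP10Real, one_mulVec, mulVec_zero] at this
  exact fun i => congrFun this i

/-! ## Curvature of diagonal metrics depending on time only -/

theorem hasFDerivAt_comp_coord {n : ℕ} {φ : ℝ → ℝ} {φ' : ℝ} (j : Fin n) {x : Fin n → ℝ}
    (h : HasDerivAt φ φ' (x j)) :
    HasFDerivAt (fun y : Fin n → ℝ => φ (y j))
      (φ' • (ContinuousLinearMap.proj j : (Fin n → ℝ) →L[ℝ] ℝ)) x :=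
  h.comp_hasFDerivAt x (hasFDerivAt_apply j x)

theorem partialDeriv_comp_coord {n : ℕ} {φ : ℝ → ℝ} {φ' : ℝ} (i j : Fin n) {x : Fin n → ℝ}
    (h : HasDerivAt φ φ' (x j)) :
    partialDeriv i (fun y => φ (y j)) x = if i = j then φ' else 0 := by
  rw [partialDeriv, (hasFDerivAt_comp_coord j h).fderiv]
  simp [Pi.single_apply, eq_comm]

/-- The closed form of the Christoffel symbols is known only over `J`; openness allows it to be
differentiated there. -/
theorem partialDeriv_eq_of_eqOn {n : ℕ} {U : Set (Fin n → ℝ)} (hU : IsOpen U)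
    {f f' : (Fin n → ℝ) → ℝ} (h : ∀ y ∈ U, f y = f' y) (i : Fin n) {x : Fin n → ℝ} (hx : x ∈ U) :
    partialDeriv i f x = partialDeriv i f' x := by
  have : f =ᶠ[nhds x] f' := Filter.eventually_of_mem (hU.mem_nhds hx) h
  rw [partialDeriv, partialDeriv, this.fderiv_eq]

theorem diagonal_inv {n : ℕ} {d : Fin n → ℝ} (h : ∀ i, d i ≠ 0) :
    (diagonal d)⁻¹ = diagonal fun i => (d i)⁻¹ := by
  apply Matrix.inv_eq_left_inv
  rw [diagonal_mul_diagonal]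
  simp [h]

/-- Coefficients `d` of a diagonal metric depending on the coordinate `0` in an open set `J`, with
half logarithmic derivatives `h`, whose derivatives are `h'`. -/
structure IsDiagonalData {m : ℕ} (J : Set ℝ) (d h h' : Fin (m + 1) → ℝ → ℝ) : Prop where
  isOpen : IsOpen J
  ne_zero : ∀ i, ∀ t ∈ J, d i t ≠ 0
  deriv_coeff : ∀ i, ∀ t ∈ J, HasDerivAt (d i) (2 * h i t * d i t) t
  deriv_log : ∀ i, ∀ t ∈ J, HasDerivAt (h i) (h' i t) t

section
variable {m : ℕ} {J : Set ℝ} {d h h' : Fin (m + 1) → ℝ → ℝ}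

/-- The Christoffel symbols of a diagonal metric depending on the coordinate `0`. -/
noncomputable def diagonalChristoffel (d h : Fin (m + 1) → ℝ → ℝ) (k i j : Fin (m + 1)) (t : ℝ) : ℝ :=
  (if i = 0 ∧ j = k then h k t else 0) + (if j = 0 ∧ i = k then h k t else 0)
    - (if k = 0 ∧ i = j then d i t / d 0 t * h i t else 0)

/-- The time derivatives of the Christoffel symbols. -/
noncomputable def diagonalChristoffelDeriv (d h h' : Fin (m + 1) → ℝ → ℝ) (k i j : Fin (m + 1)) (t : ℝ) : ℝ :=
  (if i = 0 ∧ j = k then h' k t else 0) + (if j = 0 ∧ i = k then h' k t else 0)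
    - (if k = 0 ∧ i = j then
        d i t / d 0 t * (h' i t + 2 * (h i t - h 0 t) * h i t) else 0)

theorem IsDiagonalData.hasDerivAt_christoffel (H : IsDiagonalData J d h h')
    (k i j : Fin (m + 1)) {t : ℝ} (ht : t ∈ J) :
    HasDerivAt (diagonalChristoffel d h k i j) (diagonalChristoffelDeriv d h h' k i j t) t := by
  have hite : ∀ (p : Prop) [Decidable p] {f : ℝ → ℝ} {f' : ℝ}, HasDerivAt f f' t →
      HasDerivAt (fun t => if p then f t else 0) (if p then f' else 0) t := by
    intro p _ f f' hf
    split_ifs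
    · exact hf
    · exact hasDerivAt_const t 0
  refine ((hite _ (H.deriv_log k t ht)).add (hite _ (H.deriv_log k t ht))).sub (hite _ ?_)
  have h0 := H.ne_zero 0 t ht
  refine (((H.deriv_coeff i t ht).div (H.deriv_coeff 0 t ht) h0).mul
    (H.deriv_log i t ht)).congr_deriv ?_
  simp only [Pi.div_apply]
  field_simp
  ring

/-- The diagonal metric with coefficients `d` depending on the coordinate `0`. -/
noncomputable def diagonalMetric (d : Fin (m + 1) → ℝ → ℝ) (x : Fin (m + 1) → ℝ) :
    Matrix (Fin (m + 1)) (Fin (m + 1)) ℝ :=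
  diagonal fun i => d i (x 0)

theorem IsDiagonalData.partialDeriv_metric (H : IsDiagonalData J d h h')
    {x : Fin (m + 1) → ℝ} (hx : x 0 ∈ J) (l i j : Fin (m + 1)) :
    partialDeriv l (fun y => diagonalMetric d y i j) x =
      if l = 0 ∧ i = j then 2 * h i (x 0) * d i (x 0) else 0 := by
  by_cases hij : i = j
  · subst hij
    simp only [diagonalMetric, diagonal_apply_eq, and_true]
    exact partialDeriv_comp_coord l 0 (H.deriv_coeff i _ hx)
  · simp only [diagonalMetric, diagonal_apply_ne _ hij, hij, and_false, if_false]
    simp [partialDeriv]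

theorem IsDiagonalData.christoffel_eq (H : IsDiagonalData J d h h')
    {x : Fin (m + 1) → ℝ} (hx : x 0 ∈ J) (k i j : Fin (m + 1)) :
    christoffel (diagonalMetric d) k i j x = diagonalChristoffel d h k i j (x 0) := by
  have hk := H.ne_zero k _ hx
  have h0 := H.ne_zero 0 _ hx
  simp only [christoffel, H.partialDeriv_metric hx]
  rw [diagonalMetric, diagonal_inv fun i => H.ne_zero i _ hx,
    Finset.sum_eq_single k (fun l _ hl => by rw [diagonal_apply_ne _ hl.symm, zero_mul]) (by simp),
    diagonal_apply_eq, diagonalChristoffel]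
  have e1 : (i = 0 ∧ k = j) ↔ (i = 0 ∧ j = k) := by rw [eq_comm (a := k)]
  have e2 : (j = 0 ∧ k = i) ↔ (j = 0 ∧ i = k) := by rw [eq_comm (a := k)]
  simp only [e1, e2]
  by_cases hk0 : k = 0
  · subst hk0
    simp only [true_and]
    split_ifs <;> field_simp <;> ring
  · simp only [hk0, false_and, if_false]
    split_ifs <;> field_simp <;> ring

theorem isOpen_coord_preimage (hJ : IsOpen J) : IsOpen {x : Fin (m + 1) → ℝ | x 0 ∈ J} :=
  hJ.preimage (continuous_apply 0)

theorem IsDiagonalData.partialDeriv_christoffel (H : IsDiagonalData J d h h')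
    {x : Fin (m + 1) → ℝ} (hx : x 0 ∈ J) (l k i j : Fin (m + 1)) :
    partialDeriv l (christoffel (diagonalMetric d) k i j) x =
      if l = 0 then diagonalChristoffelDeriv d h h' k i j (x 0) else 0 := by
  rw [partialDeriv_eq_of_eqOn (isOpen_coord_preimage H.isOpen)
    (fun y hy => H.christoffel_eq hy k i j) l hx]
  exact partialDeriv_comp_coord l 0 (H.hasDerivAt_christoffel k i j hx)

theorem IsDiagonalData.ricci_eq (H : IsDiagonalData J d h h')
    {x : Fin (m + 1) → ℝ} (hx : x 0 ∈ J) (i j : Fin (m + 1)) :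
    ricci (diagonalMetric d) i j x =
      ∑ k, ((if k = 0 then diagonalChristoffelDeriv d h h' k i j (x 0) else 0)
        - (if j = 0 then diagonalChristoffelDeriv d h h' k i k (x 0) else 0)) +
      ∑ k, ∑ l, (diagonalChristoffel d h k k l (x 0) * diagonalChristoffel d h l i j (x 0)
        - diagonalChristoffel d h k j l (x 0) * diagonalChristoffel d h l i k (x 0)) := by
  simp only [ricci, H.partialDeriv_christoffel hx, H.christoffel_eq hx]

/-- The contributions with `k = 0` cancel, so only spatial directions remain. -/
theorem IsDiagonalData.ricci_zero_zero (H : IsDiagonalData J d h h')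
    {x : Fin (m + 1) → ℝ} (hx : x 0 ∈ J) :
    ricci (diagonalMetric d) 0 0 x = ∑ a : Fin m, (h 0 (x 0) * h a.succ (x 0)
      - h' a.succ (x 0) - h a.succ (x 0) ^ 2) := by
  have h0 := H.ne_zero 0 _ hx
  rw [H.ricci_eq hx]
  simp [diagonalChristoffel, diagonalChristoffelDeriv, Fin.sum_univ_succ, Fin.succ_ne_zero, h0,
    (Fin.succ_ne_zero _).symm, Finset.sum_add_distrib, Finset.sum_sub_distrib]
  simp only [mul_comm (h 0 (x 0)), pow_two]
  ring

/-- The factor `∑ b, h b.succ - h 0` vanishes for harmonic time, leaving an expression linear in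
second derivatives of the logarithms of the coefficients. -/
theorem IsDiagonalData.ricci_succ_succ (H : IsDiagonalData J d h h')
    {x : Fin (m + 1) → ℝ} (hx : x 0 ∈ J) (a : Fin m) :
    ricci (diagonalMetric d) a.succ a.succ x = -(d a.succ (x 0) / d 0 (x 0)) *
      (h' a.succ (x 0) + (∑ b : Fin m, h b.succ (x 0) - h 0 (x 0)) * h a.succ (x 0)) := by
  have h0 := H.ne_zero 0 _ hx
  rw [H.ricci_eq hx]
  simp [diagonalChristoffel, diagonalChristoffelDeriv, Fin.sum_univ_succ, Fin.succ_ne_zero, h0,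
    (Fin.succ_ne_zero _).symm, Finset.sum_add_distrib, Finset.sum_sub_distrib]
  rw [← Finset.sum_mul]
  ring

theorem IsDiagonalData.ricci_of_ne (H : IsDiagonalData J d h h')
    {x : Fin (m + 1) → ℝ} (hx : x 0 ∈ J) {i j : Fin (m + 1)} (hij : i ≠ j) :
    ricci (diagonalMetric d) i j x = 0 := by
  have h0 := H.ne_zero 0 _ hx
  rw [H.ricci_eq hx]
  cases i using Fin.cases with
  | zero =>
    cases j using Fin.cases with
    | zero => exact absurd rfl hij
    | succ b =>
      simp [diagonalChristoffel, diagonalChristoffelDeriv, Fin.sum_univ_succ, Fin.succ_ne_zero, h0,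
        (Fin.succ_ne_zero _).symm, Finset.sum_add_distrib, Finset.sum_sub_distrib]
  | succ a =>
    cases j using Fin.cases with
    | zero =>
      simp [diagonalChristoffel, diagonalChristoffelDeriv, Fin.sum_univ_succ, Fin.succ_ne_zero, h0,
    (Fin.succ_ne_zero _).symm, Finset.sum_add_distrib, Finset.sum_sub_distrib]
    | succ b =>
      have hab : a ≠ b := fun h => hij (h ▸ rfl)
      simp [diagonalChristoffel, diagonalChristoffelDeriv, Fin.sum_univ_succ, Fin.succ_ne_zero, hab,
        hab.symm, Finset.sum_add_distrib]

end

/-! ## Components of decomposable forms -/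

section
variable {n p : ℕ}

theorem formComp_coordForm (I K : Fin p → Fin n) :
    formComp (coordForm I) K =
      ∑ σ : Equiv.Perm (Fin p), (Equiv.Perm.sign σ : ℝ) * if K = I ∘ σ then 1 else 0 := by
  have h : formComp (coordForm I) K =
      Matrix.det (Matrix.of fun a b => (Pi.single (K a) (1 : ℝ) : Fin n → ℝ) (I b)) := rfl
  -- The Leibniz formula permutes the rows, so the term of `σ` requires `K ∘ σ = I`; passing to
  -- inverses turns this into `K = I ∘ σ`.
  rw [h, det_apply', ← Equiv.sum_comp (Equiv.inv (Equiv.Perm (Fin p)))]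
  refine Finset.sum_congr rfl fun σ _ => ?_
  simp only [Equiv.inv_apply, Equiv.Perm.sign_inv, Pi.single_apply, of_apply]
  congr 1
  by_cases h : K = I ∘ σ
  · rw [if_pos h, h]
    exact Finset.prod_eq_one fun b _ => by simp
  · rw [if_neg h]
    obtain ⟨a, ha⟩ := Function.ne_iff.1 h
    refine Finset.prod_eq_zero (Finset.mem_univ (σ a)) ?_
    simpa using Ne.symm ha

theorem exists_perm_of_formComp_ne_zero {I K : Fin p → Fin n}
    (h : formComp (coordForm I) K ≠ 0) : ∃ σ : Equiv.Perm (Fin p), K = I ∘ σ := by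
  by_contra! hK
  exact h (by rw [formComp_coordForm]; simp [hK])

/-- As `I` is injective, at most one permutation matches `K`, and its sign squares to `1`. -/
theorem formComp_coordForm_sq {I : Fin p → Fin n} (hI : Function.Injective I)
    (K : Fin p → Fin n) :
    formComp (coordForm I) K * formComp (coordForm I) K =
      ∑ σ : Equiv.Perm (Fin p), if K = I ∘ σ then 1 else 0 := by
  rw [formComp_coordForm]
  by_cases hK : ∃ σ : Equiv.Perm (Fin p), K = I ∘ σ
  · obtain ⟨σ, rfl⟩ := hK
    have h : ∀ τ : Equiv.Perm (Fin p), (I ∘ σ = I ∘ τ) ↔ σ = τ := fun τ =>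
      ⟨fun h => Equiv.ext fun a => hI (congrFun h a), fun h => h ▸ rfl⟩
    simp only [h]
    rcases Int.units_eq_one_or (Equiv.Perm.sign σ) with h' | h' <;> simp [h']
  · push Not at hK
    simp [hK]

theorem formComp_sum {S : Type*} [Fintype S] (c : S → ℝ)
    (F : S → (Fin n → ℝ) [⋀^Fin p]→L[ℝ] ℝ) (K : Fin p → Fin n) :
    formComp (∑ s, c s • F s) K = ∑ s, c s * formComp (F s) K := by
  simp [formComp, ContinuousAlternatingMap.sum_apply]

theorem upComp_of_inv_eq_diagonal {g : Matrix (Fin n) (Fin n) ℝ} {w : Fin n → ℝ}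
    (hg : g⁻¹ = diagonal w) (F : (Fin n → ℝ) [⋀^Fin p]→L[ℝ] ℝ) (K : Fin p → Fin n) :
    upComp g F K = (∏ a, w (K a)) * formComp F K := by
  rw [upComp, hg, Finset.sum_eq_single K]
  · simp
  · intro N _ hN
    obtain ⟨a, ha⟩ := Function.ne_iff.1 hN
    rw [Finset.prod_eq_zero (f := fun a => diagonal w (K a) (N a)) (Finset.mem_univ a)
      (diagonal_apply_ne _ ha.symm), zero_mul]
  · simp

end

theorem formContraction_of_inv_eq_diagonal {g : Matrix (Fin 11) (Fin 11) ℝ} {w : Fin 11 → ℝ}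
    (hg : g⁻¹ = diagonal w) (F : (Fin 11 → ℝ) [⋀^Fin 4]→L[ℝ] ℝ) (M N : Fin 11) :
    formContraction g F M N = ∑ P : Fin 3 → Fin 11,
      (∏ a, w (P a)) * (formComp F (Fin.cons M P) * formComp F (Fin.cons N P)) := by
  rw [formContraction, hg]
  refine Finset.sum_congr rfl fun P _ => ?_
  rw [Finset.sum_eq_single P]
  · simp [mul_assoc]
  · intro Q _ hQ
    obtain ⟨a, ha⟩ := Function.ne_iff.1 hQ
    rw [Finset.prod_eq_zero (f := fun a => diagonal w (P a) (Q a)) (Finset.mem_univ a)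
      (diagonal_apply_ne _ ha.symm), zero_mul, zero_mul]
  · simp

theorem formSq_of_inv_eq_diagonal {g : Matrix (Fin 11) (Fin 11) ℝ} {w : Fin 11 → ℝ}
    (hg : g⁻¹ = diagonal w) (F : (Fin 11 → ℝ) [⋀^Fin 4]→L[ℝ] ℝ) :
    formSq g F = ∑ M, w M * formContraction g F M M := by
  simp only [formSq, upComp_of_inv_eq_diagonal hg, formContraction_of_inv_eq_diagonal hg]
  rw [← (Fin.consEquiv fun _ : Fin 4 => Fin 11).sum_comp, Fintype.sum_prod_type]
  refine Finset.sum_congr rfl fun M _ => ?_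
  rw [Finset.mul_sum]
  refine Finset.sum_congr rfl fun P _ => ?_
  change formComp F (Fin.cons M P) *
    ((∏ a, w ((Fin.cons M P : Fin 4 → Fin 11) a)) * formComp F (Fin.cons M P)) = _
  rw [Fin.prod_univ_succ]
  simp only [Fin.cons_zero, Fin.cons_succ]
  ring

/-- Two decomposable 4-forms with at most two common directions have no common three indices. -/
theorem formComp_cons_mul_eq_zero {I I' : Fin 4 → Fin 11}
    (hI : Function.Injective I)
    (h : (Finset.univ.image I ∩ Finset.univ.image I').card ≤ 2)
    (M N : Fin 11) (P : Fin 3 → Fin 11) :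
    formComp (coordForm I) (Fin.cons M P) * formComp (coordForm I') (Fin.cons N P) = 0 := by
  by_contra h0
  obtain ⟨σ, hσ⟩ := exists_perm_of_formComp_ne_zero (left_ne_zero_of_mul h0)
  obtain ⟨τ, hτ⟩ := exists_perm_of_formComp_ne_zero (right_ne_zero_of_mul h0)
  have hP : ∀ a, P a = I (σ a.succ) := fun a => by simpa using congrFun hσ a.succ
  have hP' : ∀ a, P a = I' (τ a.succ) := fun a => by simpa using congrFun hτ a.succ
  have hinj : Function.Injective P := fun a b hab => by
    rw [hP, hP] at hab
    simpa using hI hab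
  have hsub : Finset.univ.image P ⊆ Finset.univ.image I ∩ Finset.univ.image I' := by
    intro x hx
    obtain ⟨a, -, rfl⟩ := Finset.mem_image.1 hx
    exact Finset.mem_inter.2 ⟨hP a ▸ Finset.mem_image_of_mem _ (Finset.mem_univ _),
      hP' a ▸ Finset.mem_image_of_mem _ (Finset.mem_univ _)⟩
  have := Finset.card_le_card hsub
  rw [Finset.card_image_of_injective _ hinj] at this
  simp at this
  omega

/-- Three of the four directions of a decomposable form determine the fourth. -/
theorem formComp_cons_mul_of_ne {I : Fin 4 → Fin 11} (hI : Function.Injective I)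
    {M N : Fin 11} (hMN : M ≠ N) (P : Fin 3 → Fin 11) :
    formComp (coordForm I) (Fin.cons M P) * formComp (coordForm I) (Fin.cons N P) = 0 := by
  by_contra h0
  obtain ⟨σ, hσ⟩ := exists_perm_of_formComp_ne_zero (left_ne_zero_of_mul h0)
  obtain ⟨τ, hτ⟩ := exists_perm_of_formComp_ne_zero (right_ne_zero_of_mul h0)
  have h1 : ∀ a, I (σ (Fin.succ a)) = I (τ (Fin.succ a)) := fun a => by
    have h1 := congrFun hσ a.succ
    have h2 := congrFun hτ a.succ
    simp only [Fin.cons_succ, Function.comp] at h1 h2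
    rw [← h1, ← h2]
  have h2 : ∀ a : Fin 3, σ a.succ = τ a.succ := fun a => hI (h1 a)
  -- The permutations agree on the last three slots, so only slot `0` is left for the remaining
  -- value.
  have h3 : σ 0 = τ 0 := by
    obtain ⟨b, hb⟩ := τ.surjective (σ 0)
    cases b using Fin.cases with
    | zero => exact hb.symm
    | succ a =>
      rw [← h2] at hb
      exact absurd (σ.injective hb) (Fin.succ_ne_zero a)
  apply hMN
  have hM := congrFun hσ 0
  have hN := congrFun hτ 0
  simp only [Fin.cons_zero, Function.comp] at hM hN
  rw [hM, hN, h3]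

theorem card_perm_apply_zero (b : Fin 4) :
    (Finset.univ.filter fun σ : Equiv.Perm (Fin 4) => σ 0 = b).card = 6 := by
  revert b; decide +kernel

/-- If `M` is a direction of the form, `3! = 6` orderings of its directions begin with `M`, and each
carries the same weight. -/
theorem sum_formComp_coordForm_sq {I : Fin 4 → Fin 11} (hI : Function.Injective I)
    (w : Fin 11 → ℝ) (M : Fin 11) :
    w M * ∑ P : Fin 3 → Fin 11, (∏ a, w (P a)) *
      (formComp (coordForm I) (Fin.cons M P) * formComp (coordForm I) (Fin.cons M P)) =
    if M ∈ Finset.univ.image I then 6 * ∏ a, w (I a) else 0 := by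
  have h1 : ∀ (σ : Equiv.Perm (Fin 4)) (P : Fin 3 → Fin 11),
      ((Fin.cons M P : Fin 4 → Fin 11) = I ∘ σ) ↔
        (I (σ 0) = M ∧ P = fun a => I (σ a.succ)) := by
    intro σ P
    constructor
    · intro h
      exact ⟨by simpa using (congrFun h 0).symm, funext fun a => by simpa using congrFun h a.succ⟩
    · rintro ⟨rfl, rfl⟩
      funext b
      cases b using Fin.cases <;> simp
  have h2 : ∀ σ : Equiv.Perm (Fin 4), ∑ P : Fin 3 → Fin 11, w M * ((∏ a, w (P a)) *
      (if (Fin.cons M P : Fin 4 → Fin 11) = I ∘ σ then 1 else 0)) =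
      if I (σ 0) = M then ∏ a, w (I a) else 0 := by
    intro σ
    simp only [h1]
    split_ifs with h
    · simp only [h, true_and, mul_ite, mul_one, mul_zero]
      rw [Finset.sum_ite_eq' Finset.univ (fun a : Fin 3 => I (σ a.succ)), if_pos (Finset.mem_univ _),
        ← Equiv.prod_comp σ, Fin.prod_univ_succ (n := 3), h]
    · simp [h]
  simp_rw [formComp_coordForm_sq hI, Finset.mul_sum]
  rw [Finset.sum_comm]
  simp only [h2]
  split_ifs with h
  · obtain ⟨b, -, rfl⟩ := Finset.mem_image.1 h
    simp only [hI.eq_iff]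
    rw [← Finset.sum_filter, Finset.sum_const, card_perm_apply_zero]
    simp
  · refine Finset.sum_eq_zero fun σ _ => if_neg fun h' => h ?_
    exact h' ▸ Finset.mem_image_of_mem _ (Finset.mem_univ _)

section
variable {S : Type*} [Fintype S] {I : S → Fin 4 → Fin 11}

theorem formContraction_sum_coordForm_of_ne (hI : ∀ s, Function.Injective (I s))
    (hcross : ∀ s s', s ≠ s' →
      (Finset.univ.image (I s) ∩ Finset.univ.image (I s')).card ≤ 2)
    {g : Matrix (Fin 11) (Fin 11) ℝ} {w : Fin 11 → ℝ} (hg : g⁻¹ = diagonal w) (c : S → ℝ)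
    {M N : Fin 11} (hMN : M ≠ N) :
    formContraction g (∑ s, c s • coordForm (I s)) M N = 0 := by
  rw [formContraction_of_inv_eq_diagonal hg]
  refine Finset.sum_eq_zero fun P _ => ?_
  simp only [formComp_sum, Finset.sum_mul_sum]
  rw [Finset.sum_eq_zero, mul_zero]
  refine fun s _ => Finset.sum_eq_zero fun s' _ => ?_
  rw [mul_mul_mul_comm]
  by_cases hs : s = s'
  · subst hs
    rw [formComp_cons_mul_of_ne (hI s) hMN, mul_zero]
  · rw [formComp_cons_mul_eq_zero (hI s) (hcross s s' hs), mul_zero]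

theorem formContraction_sum_coordForm_self (hI : ∀ s, Function.Injective (I s))
    (hcross : ∀ s s', s ≠ s' →
      (Finset.univ.image (I s) ∩ Finset.univ.image (I s')).card ≤ 2)
    {g : Matrix (Fin 11) (Fin 11) ℝ} {w : Fin 11 → ℝ} (hg : g⁻¹ = diagonal w) (c : S → ℝ)
    (M : Fin 11) :
    w M * formContraction g (∑ s, c s • coordForm (I s)) M M =
      6 * ∑ s, if M ∈ Finset.univ.image (I s) then c s ^ 2 * ∏ a, w (I s a) else 0 := by
  rw [formContraction_of_inv_eq_diagonal hg]
  have h : ∀ P : Fin 3 → Fin 11, formComp (∑ s, c s • coordForm (I s)) (Fin.cons M P) *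
      formComp (∑ s, c s • coordForm (I s)) (Fin.cons M P) = ∑ s, c s ^ 2 *
      (formComp (coordForm (I s)) (Fin.cons M P) * formComp (coordForm (I s)) (Fin.cons M P)) := by
    intro P
    simp only [formComp_sum, Finset.sum_mul_sum]
    refine Finset.sum_congr rfl fun s _ => ?_
    rw [Finset.sum_eq_single s]
    · ring
    · intro s' _ hs
      rw [mul_mul_mul_comm, formComp_cons_mul_eq_zero (hI s) (hcross s s' hs.symm), mul_zero]
    · simp
  simp only [h, Finset.mul_sum]
  rw [Finset.sum_comm]
  refine Finset.sum_congr rfl fun s _ => ?_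
  have h2 := congrArg (c s ^ 2 * ·) (sum_formComp_coordForm_sq (hI s) w M)
  simp only [Finset.mul_sum] at h2
  convert h2 using 1
  · refine Finset.sum_congr rfl fun P _ => ?_
    ring
  · split_ifs <;> ring

theorem formSq_sum_coordForm (hI : ∀ s, Function.Injective (I s))
    (hcross : ∀ s s', s ≠ s' →
      (Finset.univ.image (I s) ∩ Finset.univ.image (I s')).card ≤ 2)
    {g : Matrix (Fin 11) (Fin 11) ℝ} {w : Fin 11 → ℝ} (hg : g⁻¹ = diagonal w) (c : S → ℝ) :
    formSq g (∑ s, c s • coordForm (I s)) = 24 * ∑ s, c s ^ 2 * ∏ a, w (I s a) := by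
  rw [formSq_of_inv_eq_diagonal hg]
  simp only [formContraction_sum_coordForm_self hI hcross hg]
  rw [← Finset.mul_sum, Finset.sum_comm]
  -- Each decomposable term is counted once for each of its four directions; with the factor `6`
  -- this makes `24 = 4!`.
  have : ∀ s, ∑ M, (if M ∈ Finset.univ.image (I s) then c s ^ 2 * ∏ a, w (I s a) else 0) =
      4 * (c s ^ 2 * ∏ a, w (I s a)) := fun s => by
    rw [← Finset.sum_filter, Finset.sum_const, Finset.filter_univ_mem,
      Finset.card_image_of_injective _ (hI s)]
    simp
  simp only [this, ← Finset.mul_sum]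
  ring

end

/-! ## Wedge products and exterior derivatives -/

/-- An alternating map is determined by its values on tuples of distinct basis vectors. There the
index `i` occurs at most once, so in each shuffle one of the two factors lacks it and vanishes. -/
theorem wedge_self_eq_zero {n p : ℕ} {F : (Fin n → ℝ) [⋀^Fin p]→L[ℝ] ℝ} (i : Fin n)
    (h : ∀ K : Fin p → Fin n, (∀ a, K a ≠ i) → formComp F K = 0) : wedge F F = 0 := by
  refine Module.Basis.ext_alternating (Pi.basisFun ℝ (Fin n)) fun K hK => ?_
  simp only [wedge, LinearMap.compAlternatingMap_apply, AlternatingMap.domCoprod_apply,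
    AlternatingMap.zero_apply, _root_.sum_apply, map_sum, Pi.basisFun_apply]
  refine Finset.sum_eq_zero fun σ _ => ?_
  induction σ using Quotient.inductionOn' with
  | h σ =>
    rw [AlternatingMap.domCoprod.summand_mk'']
    simp only [_root_.smul_apply, MultilinearMap.domDomCongr_apply,
      MultilinearMap.domCoprod_apply]
    by_cases h1 : ∀ a, K (σ (Sum.inl a)) ≠ i
    · have := h (fun a => K (σ (Sum.inl a))) h1
      simp only [formComp] at this
      simp [this]
    · push Not at h1
      obtain ⟨a, ha⟩ := h1
      have h2 : ∀ b, K (σ (Sum.inr b)) ≠ i := by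
        intro b hb
        have := σ.injective (hK (ha.trans hb.symm))
        simp at this
      have := h (fun b => K (σ (Sum.inr b))) h2
      simp only [formComp] at this
      simp [this]

theorem coordForm_apply {n p : ℕ} (I : Fin p → Fin n) (v : Fin p → Fin n → ℝ) :
    coordForm I v = Matrix.det (Matrix.of fun a b => v a (I b)) := rfl

/-- The alternating sum defining the exterior derivative is the cofactor expansion of the larger
determinant along its first column. -/
theorem extDeriv_smul_coordForm {n p : ℕ} {φ : ℝ → ℝ} {φ' : ℝ} (j : Fin n) {x : Fin n → ℝ}
    (h : HasDerivAt φ φ' (x j)) (I : Fin p → Fin n) :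
    extDeriv (fun y : Fin n → ℝ => φ (y j) • coordForm I) x =
      φ' • coordForm (Fin.cons j I : Fin (p + 1) → Fin n) := by
  have hd := (hasFDerivAt_comp_coord j h).smul_const (coordForm I)
  ext v
  rw [extDeriv, hd.fderiv, ContinuousAlternatingMap.alternatizeUncurryFin_apply]
  simp only [ContinuousAlternatingMap.smul_apply, coordForm_apply]
  rw [det_succ_column_zero, smul_eq_mul, Finset.mul_sum]
  refine Finset.sum_congr rfl fun a _ => ?_
  simp [coordForm_apply, Matrix.submatrix, Fin.removeNth]
  ring

theorem differentiableAt_smul_coordForm {n p : ℕ} {φ : ℝ → ℝ} {φ' : ℝ} (j : Fin n)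
    {x : Fin n → ℝ} (h : HasDerivAt φ φ' (x j)) (I : Fin p → Fin n) :
    DifferentiableAt ℝ (fun y : Fin n → ℝ => φ (y j) • coordForm I) x :=
  ((hasFDerivAt_comp_coord j h).smul_const (coordForm I)).differentiableAt

theorem extDeriv_sum_smul_coordForm {S : Type*} [Fintype S] {n p : ℕ} {φ : S → ℝ → ℝ}
    {φ' : S → ℝ} (j : Fin n) {x : Fin n → ℝ} (h : ∀ s, HasDerivAt (φ s) (φ' s) (x j))
    (I : S → Fin p → Fin n) :
    extDeriv (fun y : Fin n → ℝ => ∑ s, φ s (y j) • coordForm (I s)) x =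
      ∑ s, φ' s • coordForm (Fin.cons j (I s) : Fin (p + 1) → Fin n) := by
  simp only [← extDeriv_smul_coordForm j (h _), extDeriv,
    ← ContinuousAlternatingMap.alternatizeUncurryFinCLM_apply]
  rw [fderiv_fun_sum fun s _ => differentiableAt_smul_coordForm j (h s) (I s), map_sum]

/-! ## The brane solution -/

/-- Half the logarithm of the absolute value of the `i`-th metric coefficient, as a linear function
of the `q^s`. -/
noncomputable def logCoeff (u : Fin 10 → ℝ) (i : Fin 11) : ℝ :=
  -(1 / 6) * ∑ s, u s + 1 / 2 * ∑ s, if i ∈ braneSet s then u s else 0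

theorem logCoeff_zero (u : Fin 10 → ℝ) : logCoeff u 0 = -(1 / 6) * ∑ s, u s := by
  simp [logCoeff, zero_notMem_braneSet]

theorem logCoeff_succ (u : Fin 10 → ℝ) (a : Fin 10) :
    logCoeff u a.succ = -(1 / 6) * ∑ s, u s + 1 / 2 * ∑ s, u s * braneCovector s a := by
  simp [logCoeff, braneCovector]

theorem sum_sum_mul_braneCovector (u : Fin 10 → ℝ) :
    ∑ a, ∑ s, u s * braneCovector s a = 3 * ∑ s, u s := by
  rw [Finset.sum_comm]
  simp only [← Finset.mul_sum, sum_braneCovector]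
  rw [← Finset.sum_mul, mul_comm]

/-- Expanding the square produces the intersection numbers `1 + A_{ss'}`: the `1` gives the square
of the sum, the rest the Toda quadratic form. -/
theorem sum_sq_sum_mul_braneCovector (u : Fin 10 → ℝ) :
    ∑ a, (∑ s, u s * braneCovector s a) ^ 2 =
      (∑ s, u s) ^ 2 + ∑ s, ∑ s', cartanP10Real s s' * u s * u s' := by
  simp only [pow_two, Finset.sum_mul_sum]
  rw [Finset.sum_comm]
  rw [← Finset.sum_add_distrib]
  refine Finset.sum_congr rfl fun s _ => ?_
  rw [Finset.sum_comm, ← Finset.sum_add_distrib]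
  refine Finset.sum_congr rfl fun s' _ => ?_
  have := congrArg (u s * u s' * ·) (sum_braneCovector_mul s s')
  simp only [Finset.mul_sum] at this
  rw [show u s * u s' + cartanP10Real s s' * u s * u s' = u s * u s' * (1 + cartanP10Real s s') by
    ring, ← this]
  exact Finset.sum_congr rfl fun a _ => by ring

/-- The harmonic gauge: the spatial sum is `-10/6 + 3/2 = -1/6` times `∑ s, u s`, as each brane
covers three of ten directions. -/
theorem sum_logCoeff_succ (u : Fin 10 → ℝ) : ∑ a : Fin 10, logCoeff u a.succ = logCoeff u 0 := by
  simp only [logCoeff_succ, logCoeff_zero, Finset.sum_add_distrib, ← Finset.mul_sum,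
    sum_sum_mul_braneCovector]
  simp
  ring

theorem sum_logCoeff (u : Fin 10 → ℝ) : ∑ i, logCoeff u i = 2 * logCoeff u 0 := by
  rw [Fin.sum_univ_succ, sum_logCoeff_succ]; ring

theorem sum_logCoeff_succ_sq (u : Fin 10 → ℝ) :
    ∑ a : Fin 10, logCoeff u a.succ ^ 2 =
      logCoeff u 0 ^ 2 + 1 / 4 * ∑ s, ∑ s', cartanP10Real s s' * u s * u s' := by
  have h : ∀ a : Fin 10, logCoeff u a.succ ^ 2 = (1 / 36) * (∑ s, u s) ^ 2
      - (1 / 6) * (∑ s, u s) * (∑ s, u s * braneCovector s a)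
      + 1 / 4 * (∑ s, u s * braneCovector s a) ^ 2 := fun a => by rw [logCoeff_succ]; ring
  simp only [h, Finset.sum_add_distrib, Finset.sum_sub_distrib, ← Finset.mul_sum,
    sum_sum_mul_braneCovector, sum_sq_sum_mul_braneCovector, logCoeff_zero]
  simp
  ring

theorem sum_braneDir_mem (s s' : Fin 10) :
    ∑ a : Fin 3, (if braneDir s a ∈ braneSet s' then (1 : ℤ) else 0) = 1 + cartanP10 s s' := by
  have h : ∀ p : Fin 10 × Fin 10,
      ∑ a : Fin 3, (if braneDir p.1 a ∈ braneSet p.2 then (1 : ℤ) else 0) =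
        1 + cartanP10 p.1 p.2 := by decide +kernel
  exact h (s, s')

/-- This links the geometry to the Toda chain: the three terms `-1/6` cancel the `1` in `1 +
A_{ss'}`, so the volume of a brane is governed by the Toda exponent. -/
theorem sum_logCoeff_braneDir (u : Fin 10 → ℝ) (s : Fin 10) :
    2 * ∑ a, logCoeff u (braneDir s a) = ∑ s', cartanP10Real s s' * u s' := by
  have h : ∀ s', ∑ a : Fin 3, (if braneDir s a ∈ braneSet s' then u s' else 0) =
      u s' + cartanP10Real s s' * u s' := fun s' => by
    have := congrArg (fun z : ℤ => (z : ℝ) * u s') (sum_braneDir_mem s s')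
    simp only [Int.cast_sum, Finset.sum_mul, cartanP10Real_apply] at this ⊢
    push_cast at this
    simpa [add_mul] using this
  have h' : ∑ a : Fin 3, ∑ s', (if braneDir s a ∈ braneSet s' then u s' else 0) =
      ∑ s', u s' + ∑ s', cartanP10Real s s' * u s' := by
    rw [Finset.sum_comm, ← Finset.sum_add_distrib]
    exact Finset.sum_congr rfl fun s' _ => h s'
  simp only [logCoeff, Finset.sum_add_distrib, ← Finset.mul_sum, h']
  simp
  ring

/-- The index tuple of the form `dt ∧ τ(I_s)`. -/
def braneIndex (s : Fin 10) : Fin 4 → Fin 11 := Fin.cons 0 (braneDir s)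

theorem injective_braneIndex (s : Fin 10) : Function.Injective (braneIndex s) := by
  have h : ∀ s, ∀ p : Fin 4 × Fin 4, braneIndex s p.1 = braneIndex s p.2 → p.1 = p.2 := by
    decide +kernel
  exact fun a b hab => h s (a, b) hab

theorem card_braneIndex_inter {s s' : Fin 10} (hs : s ≠ s') :
    (Finset.univ.image (braneIndex s) ∩ Finset.univ.image (braneIndex s')).card ≤ 2 := by
  have h : ∀ p : Fin 10 × Fin 10, p.1 ≠ p.2 →
    (Finset.univ.image (braneIndex p.1) ∩ Finset.univ.image (braneIndex p.2)).card ≤ 2 := by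
    decide +kernel
  exact h (s, s') hs

theorem zero_mem_image_braneIndex (s : Fin 10) : 0 ∈ Finset.univ.image (braneIndex s) :=
  Finset.mem_image.2 ⟨0, Finset.mem_univ _, rfl⟩

theorem succ_mem_image_braneIndex (s : Fin 10) (a : Fin 10) :
    a.succ ∈ Finset.univ.image (braneIndex s) ↔ a.succ ∈ braneSet s := by
  simp only [braneSet, Finset.mem_image, Finset.mem_univ, true_and]
  rw [Fin.exists_fin_succ]
  simp [braneIndex, Fin.cons_succ, (Fin.succ_ne_zero a).symm]

theorem sum_logCoeff_braneIndex (u : Fin 10 → ℝ) (s : Fin 10) :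
    2 * ∑ a, logCoeff u (braneIndex s a) =
      2 * logCoeff u 0 + ∑ s', cartanP10Real s s' * u s' := by
  rw [Fin.sum_univ_succ, mul_add, ← sum_logCoeff_braneDir]
  simp [braneIndex]

/-- The metric coefficients of the brane solution. -/
noncomputable def braneCoeff (q : Fin 10 → ℝ → ℝ) (i : Fin 11) (t : ℝ) : ℝ :=
  (if i = 0 then -1 else 1) * Real.exp (2 * logCoeff (fun s => q s t) i)

theorem braneMetric_eq (q : Fin 10 → ℝ → ℝ) : braneMetric q = diagonalMetric (braneCoeff q) := by
  funext x
  rw [braneMetric, diagonalMetric, ← diagonal_smul]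
  congr 1
  funext i
  have h1 : (∏ s, fFun q s (x 0)) ^ (1 / 3 : ℝ) = Real.exp (-(1 / 3) * ∑ s, q s (x 0)) := by
    simp only [fFun]
    rw [← Real.exp_sum, ← Real.exp_mul, Finset.sum_neg_distrib]
    congr 1; ring
  have h2 : (∏ s with i ∈ braneSet s, fFun q s (x 0))⁻¹ =
      Real.exp (∑ s, if i ∈ braneSet s then q s (x 0) else 0) := by
    simp only [fFun]
    rw [← Real.exp_sum, ← Real.exp_neg, Finset.sum_neg_distrib, neg_neg, Finset.sum_filter]
  simp only [Pi.smul_apply, smul_eq_mul, braneCoeff]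
  split_ifs with hi
  · subst hi
    rw [h1, logCoeff_zero, mul_comm]
    congr 2; ring
  · rw [h1, h2, ← Real.exp_add, one_mul, logCoeff]
    congr 1; ring

/-- The coefficients of the brane form. -/
noncomputable def braneCharge (Q : Fin 10 → ℝ) (q : Fin 10 → ℝ → ℝ) (s : Fin 10) (t : ℝ) : ℝ :=
  Q s * Real.exp (∑ s', cartanP10Real s s' * q s' t)

theorem braneForm_eq (Q : Fin 10 → ℝ) (q : Fin 10 → ℝ → ℝ) (x : Fin 11 → ℝ) :
    braneForm Q q x = ∑ s, braneCharge Q q s (x 0) • coordForm (braneIndex s) := by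
  refine Finset.sum_congr rfl fun s _ => ?_
  rw [braneCharge, Real.exp_sum]
  congr 3
  funext s'
  rw [fFun, ← Real.rpow_intCast, ← Real.exp_mul, cartanP10Real_apply]
  congr 1
  push_cast
  ring

theorem ne_zero_braneCoeff (q : Fin 10 → ℝ → ℝ) (i : Fin 11) (t : ℝ) : braneCoeff q i t ≠ 0 := by
  unfold braneCoeff
  split_ifs <;> simp

theorem inv_braneMetric (q : Fin 10 → ℝ → ℝ) (x : Fin 11 → ℝ) :
    (braneMetric q x)⁻¹ = diagonal fun i => (braneCoeff q i (x 0))⁻¹ := by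
  rw [braneMetric_eq]
  exact diagonal_inv fun i => ne_zero_braneCoeff q i _

theorem isLorentzian_braneMetric (q : Fin 10 → ℝ → ℝ) (x : Fin 11 → ℝ) :
    IsLorentzian (braneMetric q x) := by
  rw [braneMetric_eq]
  refine isLorentzian_diagonal ?_ fun i hi => ?_
  · simp [braneCoeff, Real.exp_pos]
  · simp [braneCoeff, Real.exp_pos, hi]

theorem prod_inv_braneCoeff (q : Fin 10 → ℝ → ℝ) (s : Fin 10) (t : ℝ) :
    ∏ a, (braneCoeff q (braneIndex s a) t)⁻¹ = -(Real.exp (2 * logCoeff (fun s => q s t) 0) *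
      Real.exp (∑ s', cartanP10Real s s' * q s' t))⁻¹ := by
  -- The time direction occurs only in slot `0`, hence exactly one minus sign.
  have h : ∏ a : Fin 4, (if braneIndex s a = 0 then (-1 : ℝ) else 1) = -1 := by
    rw [Fin.prod_univ_succ, Finset.prod_eq_one]
    · simp [braneIndex]
    · intro a _
      rw [if_neg]
      exact fun h => Fin.succ_ne_zero a (injective_braneIndex s (h.trans rfl : _ = braneIndex s 0))
  rw [← Real.exp_add, ← sum_logCoeff_braneIndex, Finset.prod_inv_distrib]
  simp only [braneCoeff]
  rw [Finset.prod_mul_distrib, h, Finset.mul_sum, Real.exp_sum, neg_one_mul, inv_neg]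

theorem sqrt_abs_det_braneMetric (q : Fin 10 → ℝ → ℝ) (x : Fin 11 → ℝ) :
    √|(braneMetric q x).det| = Real.exp (2 * logCoeff (fun s => q s (x 0)) 0) := by
  rw [braneMetric_eq, diagonalMetric, det_diagonal, Finset.abs_prod]
  have h : ∀ i, |braneCoeff q i (x 0)| = Real.exp (2 * logCoeff (fun s => q s (x 0)) i) := by
    intro i
    rw [braneCoeff, abs_mul, Real.abs_exp]
    split_ifs <;> simp
  simp only [h]
  rw [← Real.exp_sum, ← Finset.mul_sum, sum_logCoeff, Real.sqrt_eq_iff_mul_self_eq (by positivity)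
    (by positivity), ← Real.exp_add]
  congr 1; ring

/-- The volume density cancels `exp (2γ_0)`, and raising the brane indices cancels the Toda
exponential in the coefficient. The result is independent of the point, whence the Maxwell equation.
-/
theorem sqrt_abs_det_mul_upComp (Q : Fin 10 → ℝ) (q : Fin 10 → ℝ → ℝ) (x : Fin 11 → ℝ)
    (K : Fin 4 → Fin 11) :
    √|(braneMetric q x).det| * upComp (braneMetric q x) (braneForm Q q x) K =
      ∑ s, -Q s * formComp (coordForm (braneIndex s)) K := by
  rw [upComp_of_inv_eq_diagonal (inv_braneMetric q x), braneForm_eq, formComp_sum,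
    sqrt_abs_det_braneMetric, Finset.mul_sum, Finset.mul_sum]
  refine Finset.sum_congr rfl fun s _ => ?_
  by_cases hK : formComp (coordForm (braneIndex s)) K = 0
  · simp [hK]
  · obtain ⟨σ, rfl⟩ := exists_perm_of_formComp_ne_zero hK
    simp only [Function.comp_apply]
    rw [Equiv.prod_comp σ fun a => (braneCoeff q (braneIndex s a) (x 0))⁻¹, prod_inv_braneCoeff,
      braneCharge]
    field_simp

theorem wedge_braneForm_self (Q : Fin 10 → ℝ) (q : Fin 10 → ℝ → ℝ) (x : Fin 11 → ℝ) :
    wedge (braneForm Q q x) (braneForm Q q x) = 0 := by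
  refine wedge_self_eq_zero 0 fun K hK => ?_
  rw [braneForm_eq, formComp_sum]
  refine Finset.sum_eq_zero fun s _ => ?_
  by_contra h
  obtain ⟨σ, rfl⟩ := exists_perm_of_formComp_ne_zero (right_ne_zero_of_mul h)
  exact hK (σ.symm 0) (by simp [braneIndex])

/-! ### The Toda functions as data of a diagonal metric -/

section
variable {J : Set ℝ} {Q : Fin 10 → ℝ} {q : Fin 10 → ℝ → ℝ}

theorem SolvesToda.hasDerivAt (hq : SolvesToda J Q q) (hJ : IsOpen J) (s : Fin 10) {t : ℝ}
    (ht : t ∈ J) : HasDerivAt (q s) (deriv (q s) t) t :=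
  (((hq.smooth s).contDiffAt (hJ.mem_nhds ht)).differentiableAt (by simp)).hasDerivAt

theorem SolvesToda.contDiffOn_deriv (hq : SolvesToda J Q q) (hJ : IsOpen J) (s : Fin 10) :
    ContDiffOn ℝ ∞ (deriv (q s)) J :=
  (hq.smooth s).deriv_of_isOpen hJ (by simp)

theorem SolvesToda.hasDerivAt_deriv (hq : SolvesToda J Q q) (hJ : IsOpen J) (s : Fin 10) {t : ℝ}
    (ht : t ∈ J) : HasDerivAt (deriv (q s)) (deriv (deriv (q s)) t) t :=
  (((hq.contDiffOn_deriv hJ s).contDiffAt (hJ.mem_nhds ht)).differentiableAt (by simp)).hasDerivAt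

theorem hasDerivAt_logCoeff {u : Fin 10 → ℝ → ℝ} {u' : Fin 10 → ℝ} {t : ℝ}
    (h : ∀ s, HasDerivAt (u s) (u' s) t) (i : Fin 11) :
    HasDerivAt (fun t => logCoeff (fun s => u s t) i) (logCoeff u' i) t := by
  refine ((HasDerivAt.fun_sum fun s _ => h s).const_mul _).add
    ((HasDerivAt.fun_sum fun s _ => ?_).const_mul _)
  split_ifs
  · exact h s
  · exact hasDerivAt_const t 0

theorem SolvesToda.isDiagonalData (hq : SolvesToda J Q q) (hJ : IsOpen J) :
    IsDiagonalData J (braneCoeff q) (fun i t => logCoeff (fun s => deriv (q s) t) i)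
      (fun i t => logCoeff (fun s => deriv (deriv (q s)) t) i) where
  isOpen := hJ
  ne_zero i t _ := ne_zero_braneCoeff q i t
  deriv_coeff i t ht := by
    refine ((((hasDerivAt_logCoeff (fun s => hq.hasDerivAt hJ s ht) i).const_mul 2).exp).const_mul
      _).congr_deriv ?_
    rw [braneCoeff]; ring
  deriv_log i t ht := hasDerivAt_logCoeff (fun s => hq.hasDerivAt_deriv hJ s ht) i

end

/-! ### Ricci tensor, stress tensor and Einstein equations -/

section
variable {J : Set ℝ} {Q : Fin 10 → ℝ} {q : Fin 10 → ℝ → ℝ}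

/-- The potential terms `Q_s² exp (∑_{s'} A_{ss'} q^{s'})` of the Toda chain. -/
noncomputable def todaTerm (Q : Fin 10 → ℝ) (q : Fin 10 → ℝ → ℝ) (s : Fin 10) (t : ℝ) : ℝ :=
  Q s ^ 2 * Real.exp (∑ s', cartanP10Real s s' * q s' t)

theorem SolvesToda.logCoeff_deriv_deriv (hq : SolvesToda J Q q) {t : ℝ} (ht : t ∈ J)
    (i : Fin 11) :
    logCoeff (fun s => deriv (deriv (q s)) t) i =
      1 / 3 * ∑ s, todaTerm Q q s t - ∑ s, if i ∈ braneSet s then todaTerm Q q s t else 0 := by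
  have h : ∀ s, deriv (deriv (q s)) t = -2 * todaTerm Q q s t := fun s => by
    rw [hq.eqn s t ht, todaTerm]; ring
  simp only [logCoeff, h, ← Finset.mul_sum, ← mul_ite_zero]
  ring

theorem braneCharge_sq_mul_prod (Q : Fin 10 → ℝ) (q : Fin 10 → ℝ → ℝ) (s : Fin 10) (t : ℝ) :
    braneCharge Q q s t ^ 2 * ∏ a, (braneCoeff q (braneIndex s a) t)⁻¹ =
      (braneCoeff q 0 t)⁻¹ * todaTerm Q q s t := by
  rw [prod_inv_braneCoeff, braneCharge, todaTerm, braneCoeff, if_pos rfl]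
  field_simp

theorem SolvesToda.ricci_zero_zero (hq : SolvesToda J Q q) (hJ : IsOpen J)
    (hE : ∀ t ∈ J, todaEnergy Q q t = 0) {x : Fin 11 → ℝ} (hx : x 0 ∈ J) :
    ricci (braneMetric q) 0 0 x = 2 / 3 * ∑ s, todaTerm Q q s (x 0) := by
  have hE' := hE _ hx
  simp only [todaEnergy] at hE'
  rw [braneMetric_eq, (hq.isDiagonalData hJ).ricci_zero_zero hx, Finset.sum_sub_distrib,
    Finset.sum_sub_distrib, ← Finset.mul_sum, sum_logCoeff_succ, sum_logCoeff_succ,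
    sum_logCoeff_succ_sq, hq.logCoeff_deriv_deriv hx]
  simp only [zero_notMem_braneSet, if_false, Finset.sum_const_zero]
  simp only [todaTerm] at *
  -- The energy constraint replaces the remaining `-1/4 ∑ A_{ss'} q̇^s q̇^{s'}` by the sum of the
  -- potential terms; the second derivative of `γ_0` contributes `-1/3` of that sum.
  linarith

theorem SolvesToda.ricci_succ_succ (hq : SolvesToda J Q q) (hJ : IsOpen J)
    {x : Fin 11 → ℝ} (hx : x 0 ∈ J) (a : Fin 10) :
    ricci (braneMetric q) a.succ a.succ x =
      -(braneCoeff q a.succ (x 0) / braneCoeff q 0 (x 0)) *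
      (1 / 3 * ∑ s, todaTerm Q q s (x 0)
        - ∑ s, if a.succ ∈ braneSet s then todaTerm Q q s (x 0) else 0) := by
  rw [braneMetric_eq, (hq.isDiagonalData hJ).ricci_succ_succ hx, sum_logCoeff_succ,
    hq.logCoeff_deriv_deriv hx, sub_self, zero_mul, add_zero]

theorem scalarCurvature_braneMetric (q : Fin 10 → ℝ → ℝ) (x : Fin 11 → ℝ) :
    scalarCurvature (braneMetric q) x =
      ∑ i, (braneCoeff q i (x 0))⁻¹ * ricci (braneMetric q) i i x := by
  rw [scalarCurvature, inv_braneMetric]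
  refine Finset.sum_congr rfl fun i _ => ?_
  rw [Finset.sum_eq_single i (fun j _ hj => by rw [diagonal_apply_ne _ hj.symm, zero_mul])
    (by simp), diagonal_apply_eq]

theorem sum_sum_ite_mem_braneSet (u : Fin 10 → ℝ) :
    ∑ a : Fin 10, ∑ s, (if a.succ ∈ braneSet s then u s else 0) = 3 * ∑ s, u s := by
  rw [← sum_sum_mul_braneCovector]
  simp [braneCovector]

theorem SolvesToda.scalarCurvature_eq (hq : SolvesToda J Q q) (hJ : IsOpen J)
    (hE : ∀ t ∈ J, todaEnergy Q q t = 0) {x : Fin 11 → ℝ} (hx : x 0 ∈ J) :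
    scalarCurvature (braneMetric q) x =
      1 / 3 * (braneCoeff q 0 (x 0))⁻¹ * ∑ s, todaTerm Q q s (x 0) := by
  rw [scalarCurvature_braneMetric, Fin.sum_univ_succ, hq.ricci_zero_zero hJ hE hx]
  have h : ∀ a : Fin 10, (braneCoeff q a.succ (x 0))⁻¹ * ricci (braneMetric q) a.succ a.succ x =
      -(braneCoeff q 0 (x 0))⁻¹ * (1 / 3 * ∑ s, todaTerm Q q s (x 0)
        - ∑ s, if a.succ ∈ braneSet s then todaTerm Q q s (x 0) else 0) := fun a => by
    have := ne_zero_braneCoeff q a.succ (x 0)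
    rw [hq.ricci_succ_succ hJ hx]
    field_simp
  simp only [h, ← Finset.mul_sum, Finset.sum_sub_distrib, sum_sum_ite_mem_braneSet]
  simp
  ring

theorem formSq_brane (Q : Fin 10 → ℝ) (q : Fin 10 → ℝ → ℝ) (x : Fin 11 → ℝ) :
    formSq (braneMetric q x) (braneForm Q q x) =
      24 * ((braneCoeff q 0 (x 0))⁻¹ * ∑ s, todaTerm Q q s (x 0)) := by
  rw [braneForm_eq, formSq_sum_coordForm injective_braneIndex
    (fun _ _ h => card_braneIndex_inter h) (inv_braneMetric q x)]
  simp only [braneCharge_sq_mul_prod, Finset.mul_sum]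

theorem formContraction_brane_self (Q : Fin 10 → ℝ) (q : Fin 10 → ℝ → ℝ) (x : Fin 11 → ℝ)
    (M : Fin 11) :
    formContraction (braneMetric q x) (braneForm Q q x) M M =
      6 * braneCoeff q M (x 0) * ((braneCoeff q 0 (x 0))⁻¹ *
        ∑ s, if M ∈ Finset.univ.image (braneIndex s) then todaTerm Q q s (x 0) else 0) := by
  have h := formContraction_sum_coordForm_self injective_braneIndex
    (fun _ _ h => card_braneIndex_inter h) (inv_braneMetric q x)
    (fun s => braneCharge Q q s (x 0)) M
  rw [← braneForm_eq] at h
  simp only [braneCharge_sq_mul_prod, ← mul_ite_zero, ← Finset.mul_sum] at h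
  have hM := ne_zero_braneCoeff q M (x 0)
  rw [inv_mul_eq_iff_eq_mul₀ hM] at h
  rw [h]; ring

theorem SolvesToda.einstein (hq : SolvesToda J Q q) (hJ : IsOpen J)
    (hE : ∀ t ∈ J, todaEnergy Q q t = 0) {x : Fin 11 → ℝ} (hx : x 0 ∈ J) (M N : Fin 11) :
    ricci (braneMetric q) M N x -
        1 / 2 * braneMetric q x M N * scalarCurvature (braneMetric q) x =
      1 / 24 * (4 * formContraction (braneMetric q x) (braneForm Q q x) M N -
        1 / 2 * braneMetric q x M N * formSq (braneMetric q x) (braneForm Q q x)) := by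
  by_cases hMN : M = N
  · subst hMN
    rw [hq.scalarCurvature_eq hJ hE hx, formSq_brane, formContraction_brane_self]
    have hg : ∀ M, braneMetric q x M M = braneCoeff q M (x 0) := fun M => by
      rw [braneMetric_eq, diagonalMetric, diagonal_apply_eq]
    have h0 := ne_zero_braneCoeff q 0 (x 0)
    rw [hg]
    cases M using Fin.cases with
    | zero =>
      rw [hq.ricci_zero_zero hJ hE hx]
      simp only [zero_mem_image_braneIndex, if_true]
      field_simp
      ring
    | succ a =>
      rw [hq.ricci_succ_succ hJ hx]
      simp only [succ_mem_image_braneIndex]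
      field_simp
      ring
  · have h1 : ricci (braneMetric q) M N x = 0 := by
      rw [braneMetric_eq]; exact (hq.isDiagonalData hJ).ricci_of_ne hx hMN
    have h2 : braneMetric q x M N = 0 := by
      rw [braneMetric_eq, diagonalMetric, diagonal_apply_ne _ hMN]
    have h3 : formContraction (braneMetric q x) (braneForm Q q x) M N = 0 := by
      rw [braneForm_eq]
      exact formContraction_sum_coordForm_of_ne injective_braneIndex
        (fun _ _ h => card_braneIndex_inter h) (inv_braneMetric q x) _ hMN
    rw [h1, h2, h3]; ring

/-! ### Smoothness, the potential and the full system -/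

theorem contDiffOn_comp_time {φ : ℝ → ℝ} (h : ContDiffOn ℝ ∞ φ J) :
    ContDiffOn ℝ ∞ (fun x : Fin 11 → ℝ => φ (x 0)) (slab J) :=
  h.comp (contDiff_apply ℝ ℝ (0 : Fin 11)).contDiffOn fun _ hx => hx

theorem contDiffOn_sum_mul {c : Fin 10 → ℝ} (h : ∀ s, ContDiffOn ℝ ∞ (q s) J) :
    ContDiffOn ℝ ∞ (fun t => ∑ s, c s * q s t) J :=
  ContDiffOn.sum fun s _ => contDiffOn_const.mul (h s)

theorem contDiffOn_braneCoeff (h : ∀ s, ContDiffOn ℝ ∞ (q s) J) (i : Fin 11) :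
    ContDiffOn ℝ ∞ (braneCoeff q i) J := by
  have h1 : ContDiffOn ℝ ∞ (fun t => logCoeff (fun s => q s t) i) J := by
    refine (contDiffOn_const.mul (ContDiffOn.sum fun s _ => h s)).add
      (contDiffOn_const.mul (ContDiffOn.sum fun s _ => ?_))
    split_ifs
    · exact h s
    · exact contDiffOn_const
  exact contDiffOn_const.mul (contDiffOn_const.mul h1).exp

theorem contDiffOn_sum_smul_coordForm {p : ℕ} {φ : Fin 10 → ℝ → ℝ}
    (h : ∀ s, ContDiffOn ℝ ∞ (φ s) J) (I : Fin 10 → Fin p → Fin 11) :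
    ContDiffOn ℝ ∞ (fun x : Fin 11 → ℝ => ∑ s, φ s (x 0) • coordForm (I s)) (slab J) :=
  ContDiffOn.sum fun s _ => (contDiffOn_comp_time (h s)).smul contDiffOn_const

/-- The Toda equation says that the coefficient of the form is `-q̈^s / (2 Q_s)`, a time derivative.
-/
theorem SolvesToda.extDeriv_potential (hq : SolvesToda J Q q) (hJ : IsOpen J)
    (hQ : ∀ s, Q s ≠ 0) {x : Fin 11 → ℝ} (hx : x 0 ∈ J) :
    extDeriv (fun y : Fin 11 → ℝ =>
      ∑ s, (-(1 / (2 * Q s)) * deriv (q s) (y 0)) • coordForm (braneDir s)) x =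
      braneForm Q q x := by
  rw [extDeriv_sum_smul_coordForm (φ := fun s t => -(1 / (2 * Q s)) * deriv (q s) t) 0
    (fun s => (hq.hasDerivAt_deriv hJ s hx).const_mul _), braneForm_eq]
  refine Finset.sum_congr rfl fun s _ => ?_
  have := hQ s
  rw [hq.eqn s _ hx, braneCharge, braneIndex]
  congr 1
  field_simp

/-- The constant `c` is arbitrary because it multiplies the vanishing wedge square; the truncated
model and both signs of supergravity are covered at once. -/
theorem SolvesToda.solvesFieldEquations (hq : SolvesToda J Q q) (hJ : IsOpen J)
    (hQ : ∀ s, Q s ≠ 0) (hE : ∀ t ∈ J, todaEnergy Q q t = 0) (c : ℝ) :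
    SolvesFieldEquations c (slab J) (braneMetric q) (braneForm Q q) where
  smooth_metric i j := by
    rw [braneMetric_eq]
    by_cases hij : i = j
    · subst hij
      simp only [diagonalMetric, diagonal_apply_eq]
      exact contDiffOn_comp_time (contDiffOn_braneCoeff hq.smooth i)
    · simp only [diagonalMetric, diagonal_apply_ne _ hij]
      exact contDiffOn_const
  lorentzian x _ := isLorentzian_braneMetric q x
  smooth_form := by
    rw [show braneForm Q q = _ from funext (braneForm_eq Q q)]
    refine contDiffOn_sum_smul_coordForm (φ := braneCharge Q q) (fun s => ?_) _
    exact contDiffOn_const.mul (contDiffOn_sum_mul hq.smooth).exp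
  potential := ⟨_, contDiffOn_sum_smul_coordForm
    (φ := fun s t => -(1 / (2 * Q s)) * deriv (q s) t)
    (fun s => contDiffOn_const.mul (hq.contDiffOn_deriv hJ s)) braneDir,
    fun x hx => hq.extDeriv_potential hJ hQ hx⟩
  einstein x hx M N := hq.einstein hJ hE hx M N
  maxwell x hx N := by
    simp only [sqrt_abs_det_mul_upComp, wedge_braneForm_self]
    simp [partialDeriv]

end

/-! ## The special solution -/

theorem specialQ_eq {Q t₀ t : ℝ} (s : Fin 10) :
    specialQ Q t₀ s t = 2 * Real.log (|Q| * (t - t₀)) := rfl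

section
variable {Q t₀ t : ℝ}

theorem hasDerivAt_log_abs_mul_sub (hQ : Q ≠ 0) (ht : t₀ < t) :
    HasDerivAt (fun t => Real.log (|Q| * (t - t₀))) (t - t₀)⁻¹ t := by
  have h0 : t - t₀ ≠ 0 := (sub_pos.2 ht).ne'
  have hQ' := abs_ne_zero.2 hQ
  have := (((hasDerivAt_id t).sub_const t₀).const_mul |Q|).log (mul_ne_zero hQ' h0)
  refine this.congr_deriv ?_
  simp only [id]
  field_simp

theorem hasDerivAt_specialQ (hQ : Q ≠ 0) (ht : t₀ < t) (s : Fin 10) :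
    HasDerivAt (specialQ Q t₀ s) (2 * (t - t₀)⁻¹) t :=
  (hasDerivAt_log_abs_mul_sub hQ ht).const_mul 2

theorem deriv_deriv_specialQ (hQ : Q ≠ 0) (ht : t₀ < t) (s : Fin 10) :
    deriv (deriv (specialQ Q t₀ s)) t = -2 * ((t - t₀) ^ 2)⁻¹ := by
  have h : deriv (specialQ Q t₀ s) =ᶠ[nhds t] fun t => 2 * (t - t₀)⁻¹ :=
    Filter.eventually_of_mem (Ioi_mem_nhds ht) fun y hy => (hasDerivAt_specialQ hQ hy s).deriv
  rw [h.deriv_eq]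
  have h0 : t - t₀ ≠ 0 := (sub_pos.2 ht).ne'
  refine ((((hasDerivAt_id t).sub_const t₀).inv h0).const_mul 2).deriv.trans ?_
  simp only [id]
  field_simp

theorem sum_cartanP10Real_mul_specialQ (s : Fin 10) :
    ∑ s', cartanP10Real s s' * specialQ Q t₀ s' t = -(2 * Real.log (|Q| * (t - t₀))) := by
  simp only [specialQ_eq]
  rw [← Finset.sum_mul, cartanP10Real_row_sum, neg_one_mul]

theorem exp_neg_two_mul_log (hQ : Q ≠ 0) (ht : t₀ < t) :
    Real.exp (-(2 * Real.log (|Q| * (t - t₀)))) = (Q ^ 2 * (t - t₀) ^ 2)⁻¹ := by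
  have h : 0 < |Q| * (t - t₀) := mul_pos (abs_pos.2 hQ) (sub_pos.2 ht)
  rw [Real.exp_neg, two_mul, Real.exp_add, Real.exp_log h, ← pow_two, mul_pow, sq_abs]

theorem fFun_specialQ (hQ : Q ≠ 0) (ht : t₀ < t) (s : Fin 10) :
    fFun (specialQ Q t₀) s t = (|Q| * (t - t₀)) ^ (-2 : ℤ) := by
  rw [fFun, specialQ_eq, exp_neg_two_mul_log hQ ht, _root_.zpow_neg, ← sq_abs Q, ← mul_pow]
  rfl

theorem contDiffOn_log_abs_mul_sub (hQ : Q ≠ 0) :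
    ContDiffOn ℝ ∞ (fun t => Real.log (|Q| * (t - t₀))) (Set.Ioi t₀) := by
  refine ContDiffOn.log (by fun_prop) fun t ht => ?_
  exact (mul_pos (abs_pos.2 hQ) (sub_pos.2 ht)).ne'

theorem solvesToda_specialQ (hQ : Q ≠ 0) {Qs : Fin 10 → ℝ} (hQs : ∀ s, Qs s ^ 2 = Q ^ 2) :
    SolvesToda (Set.Ioi t₀) Qs (specialQ Q t₀) where
  smooth s := contDiffOn_const.mul (contDiffOn_log_abs_mul_sub hQ)
  eqn s t ht := by
    have h0 : t - t₀ ≠ 0 := (sub_pos.2 ht).ne'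
    rw [deriv_deriv_specialQ hQ ht, sum_cartanP10Real_mul_specialQ, exp_neg_two_mul_log hQ ht, hQs]
    field_simp

theorem todaEnergy_specialQ (hQ : Q ≠ 0) {Qs : Fin 10 → ℝ} (hQs : ∀ s, Qs s ^ 2 = Q ^ 2)
    (ht : t₀ < t) : todaEnergy Qs (specialQ Q t₀) t = 0 := by
  have h0 : t - t₀ ≠ 0 := (sub_pos.2 ht).ne'
  simp only [todaEnergy, sum_cartanP10Real_mul_specialQ, exp_neg_two_mul_log hQ ht, hQs,
    (hasDerivAt_specialQ hQ ht _).deriv, ← Finset.sum_mul, cartanP10Real_row_sum]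
  simp
  field_simp
  ring

/-! ### Synchronous time and the power law -/

/-- The synchronous time of the special solution. -/
noncomputable def synchronousTime (Q t₀ t : ℝ) : ℝ :=
  3 / (7 * |Q|) * Real.exp (-(7 / 3) * Real.log (|Q| * (t - t₀)))

/-- The square of this derivative is `-g_00`. The negative sign means that the synchronous time runs
backwards: it tends to `0` as `t → ∞`. -/
theorem hasDerivAt_synchronousTime (hQ : Q ≠ 0) (ht : t₀ < t) :
    HasDerivAt (synchronousTime Q t₀) (-Real.exp (-(10 / 3) * Real.log (|Q| * (t - t₀)))) t := by
  have h0 : t - t₀ ≠ 0 := (sub_pos.2 ht).ne'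
  have hQ' := abs_ne_zero.2 hQ
  refine ((((hasDerivAt_log_abs_mul_sub hQ ht).const_mul (-(7 / 3))).exp).const_mul
    (3 / (7 * |Q|))).congr_deriv ?_
  have h1 : Real.exp (-(10 / 3) * Real.log (|Q| * (t - t₀))) =
      Real.exp (-(7 / 3) * Real.log (|Q| * (t - t₀))) * (|Q| * (t - t₀))⁻¹ := by
    rw [← Real.exp_log (mul_pos (abs_pos.2 hQ) (sub_pos.2 ht)), ← Real.exp_neg, ← Real.exp_add,
      Real.log_exp]
    congr 1; ring
  rw [h1]
  field_simp

theorem contDiffOn_synchronousTime (hQ : Q ≠ 0) :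
    ContDiffOn ℝ ∞ (synchronousTime Q t₀) (Set.Ioi t₀) :=
  contDiffOn_const.mul (contDiffOn_const.mul (contDiffOn_log_abs_mul_sub hQ)).exp

theorem bijOn_synchronousTime (hQ : Q ≠ 0) :
    Set.BijOn (synchronousTime Q t₀) (Set.Ioi t₀) (Set.Ioi 0) := by
  have hQ' := abs_pos.2 hQ
  have hk : (0 : ℝ) < 3 / (7 * |Q|) := by positivity
  refine ⟨fun t _ => mul_pos hk (Real.exp_pos _), fun t ht t' ht' h => ?_, fun y hy => ?_⟩
  · have h1 := Real.exp_injective (mul_left_cancel₀ hk.ne' h)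
    have h2 := mul_left_cancel₀ (by norm_num) h1
    have h3 := Real.log_injOn_pos (mul_pos hQ' (sub_pos.2 ht)) (mul_pos hQ' (sub_pos.2 ht')) h2
    linarith [mul_left_cancel₀ hQ'.ne' h3]
  · have hy' : 0 < y / (3 / (7 * |Q|)) := div_pos hy hk
    -- The witness solves `|Q| (t - t₀) = (7 |Q| y / 3) ^ (-3/7)`.
    refine ⟨t₀ + Real.exp (-(3 / 7) * Real.log (y / (3 / (7 * |Q|)))) / |Q|, ?_, ?_⟩
    · simp only [Set.mem_Ioi, lt_add_iff_pos_right]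
      positivity
    · rw [synchronousTime, add_sub_cancel_left, mul_div_cancel₀ _ hQ'.ne', Real.log_exp, ← mul_assoc]
      norm_num
      rw [Real.exp_log hy']
      field_simp

theorem pullbackMetric_update_powerLawMetric {T : ℝ → ℝ} {T' a : ℝ} {x : Fin 11 → ℝ}
    (hT : HasDerivAt T T' (x 0)) :
    pullbackMetric (fun y => Function.update y 0 (T (y 0))) (powerLawMetric a) x =
      diagonal fun i : Fin 11 => if i = 0 then -T' ^ 2 else a * T (x 0) ^ (2 / 7 : ℝ) := by
  have h0 : ∀ i : Fin 11, partialDeriv i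
      (fun y : Fin 11 → ℝ => Function.update y 0 (T (y 0)) 0) x = if i = 0 then T' else 0 := by
    intro i
    simp only [Function.update_self]
    exact partialDeriv_comp_coord i 0 hT
  have hk : ∀ (k : Fin 10) (i : Fin 11), partialDeriv i
      (fun y : Fin 11 → ℝ => Function.update y 0 (T (y 0)) k.succ) x =
        if i = k.succ then 1 else 0 := by
    intro k i
    simp only [Function.update_of_ne (Fin.succ_ne_zero k)]
    exact partialDeriv_comp_coord i k.succ (hasDerivAt_id _)
  ext i j
  simp only [pullbackMetric, of_apply, powerLawMetric, diagonal_apply, mul_ite, mul_zero,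
    Finset.sum_ite_eq, Finset.mem_univ, if_true]
  rw [Fin.sum_univ_succ (n := 10)]
  simp only [h0, hk, Fin.succ_ne_zero, if_true, if_false]
  cases i using Fin.cases with
  | zero =>
    cases j using Fin.cases with
    | zero => simp [(Fin.succ_ne_zero _).symm]; ring
    | succ b => simp [Fin.succ_ne_zero, (Fin.succ_ne_zero _).symm]
  | succ a =>
    cases j using Fin.cases with
    | zero => simp [Fin.succ_ne_zero, (Fin.succ_ne_zero _).symm]
    | succ b =>
      simp [Fin.succ_ne_zero]

theorem sum_braneCovector_apply (a : Fin 10) : ∑ s, braneCovector s a = 3 := by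
  have h : ∀ a : Fin 10, (Finset.univ.filter fun s => a.succ ∈ braneSet s).card = 3 := by
    decide +kernel
  simp [braneCovector, h]

/-- With `f = |Q| (t - t₀)`, the conformal factor is `f ^ (-20/3)`. Each spatial direction lies in
three branes, which gives `f ^ (-20/3 + 6) = (f ^ (-7/3)) ^ (2/7)`; the prefactor of the synchronous
time is compensated by the constant of the power law. -/
theorem braneMetric_specialQ (hQ : Q ≠ 0) {x : Fin 11 → ℝ} (hx : x ∈ slab (Set.Ioi t₀)) :
    braneMetric (specialQ Q t₀) x =
      pullbackMetric (fun y => Function.update y 0 (synchronousTime Q t₀ (y 0)))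
        (powerLawMetric ((3 / (7 * |Q|)) ^ (-(2 / 7) : ℝ))) x := by
  have hk : (0 : ℝ) < 3 / (7 * |Q|) := by have := abs_pos.2 hQ; positivity
  rw [pullbackMetric_update_powerLawMetric (hasDerivAt_synchronousTime hQ hx), braneMetric_eq,
    diagonalMetric]
  congr 1
  funext i
  rw [braneCoeff]
  cases i using Fin.cases with
  | zero =>
    simp only [if_true, logCoeff_zero, specialQ_eq]
    rw [neg_sq, pow_two, ← Real.exp_add, neg_one_mul]
    congr 2
    simp
    ring
  | succ a =>
    simp only [Fin.succ_ne_zero, if_false, logCoeff_succ, specialQ_eq, one_mul, ← Finset.mul_sum,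
      sum_braneCovector_apply]
    rw [synchronousTime, Real.mul_rpow hk.le (Real.exp_pos _).le, ← mul_assoc (_ ^ _),
      ← Real.rpow_add hk, ← Real.exp_mul]
    simp
    ring

end

end PetersenSBrane

theorem mainTheorem3 :
    -- `P₁₀` is a Lorentzian Kac-Moody algebra whose Dynkin diagram is the Petersen graph
    (IsGeneralizedCartanMatrix cartanP10 ∧ cartanP10.det ≠ 0 ∧ IsLorentzian cartanP10Real ∧
      Nonempty (dynkinGraph cartanP10 ≃g petersenGraph)) ∧
    -- the ten branes obey its intersection rules, and the brane co-vectors are independent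
    (ObeysIntersectionRules cartanP10 ∧
      (∀ s, covectorProduct (braneCovector s) (braneCovector s) = 2) ∧
      LinearIndependent ℝ braneCovector) ∧
    -- the metric and the 4-form solve the equations of the model and of supergravity
    (∀ (J : Set ℝ) (Q : Fin 10 → ℝ) (q : Fin 10 → ℝ → ℝ),
      IsOpen J → J.OrdConnected → (∀ s, Q s ≠ 0) → SolvesToda J Q q →
      (∀ t ∈ J, todaEnergy Q q t = 0) →
        SolvesB11 (slab J) (braneMetric q) (braneForm Q q) ∧
        (∀ x ∈ slab J, wedge (braneForm Q q x) (braneForm Q q x) = 0) ∧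
        SolvesSupergravity (slab J) (braneMetric q) (braneForm Q q)) ∧
    -- the special solution with equal charges
    (∀ s, 2 * ∑ s', cartanP10Real⁻¹ s s' = -2) ∧
    (∀ Q : ℝ, Q ≠ 0 → ∃ a : ℝ, 0 < a ∧ ∀ t₀ : ℝ,
      (∀ s, ∀ t ∈ Set.Ioi t₀, fFun (specialQ Q t₀) s t = (|Q| * (t - t₀)) ^ (-2 : ℤ)) ∧
      (∀ Qs : Fin 10 → ℝ, (∀ s, Qs s ^ 2 = Q ^ 2) →
        SolvesToda (Set.Ioi t₀) Qs (specialQ Q t₀) ∧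
        (∀ t ∈ Set.Ioi t₀, todaEnergy Qs (specialQ Q t₀) t = 0) ∧
        SolvesB11 (slab (Set.Ioi t₀)) (braneMetric (specialQ Q t₀))
          (braneForm Qs (specialQ Q t₀)) ∧
        SolvesSupergravity (slab (Set.Ioi t₀)) (braneMetric (specialQ Q t₀))
          (braneForm Qs (specialQ Q t₀))) ∧
      -- in the synchronous time `T(t)` the metric takes the power-law form
      ∃ T : ℝ → ℝ, ContDiffOn ℝ ∞ T (Set.Ioi t₀) ∧ Set.BijOn T (Set.Ioi t₀) (Set.Ioi 0) ∧
        (∀ t ∈ Set.Ioi t₀, deriv T t ≠ 0) ∧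
        ∀ x ∈ slab (Set.Ioi t₀), braneMetric (specialQ Q t₀) x =
          pullbackMetric (fun y => Function.update y 0 (T (y 0))) (powerLawMetric a) x) := by
  refine ⟨⟨isGeneralizedCartanMatrix_cartanP10, det_cartanP10_ne_zero, isLorentzian_cartanP10Real,
    nonempty_dynkinGraph_iso_petersenGraph⟩, ⟨obeysIntersectionRules,
    covectorProduct_braneCovector_self, linearIndependent_braneCovector⟩, ?_, ?_, ?_⟩
  · intro J Q q hJ _ hQ hq hE
    have h := hq.solvesFieldEquations hJ hQ hE
    exact ⟨h 0, fun x _ => wedge_braneForm_self Q q x, h _, h _⟩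
  · intro s
    rw [cartanP10Real_inv_row_sum]
    norm_num
  · intro Q hQ
    have hk : (0 : ℝ) < 3 / (7 * |Q|) := by have := abs_pos.2 hQ; positivity
    refine ⟨(3 / (7 * |Q|)) ^ (-(2 / 7) : ℝ), Real.rpow_pos_of_pos hk _, fun t₀ =>
      ⟨fun s t ht => fFun_specialQ hQ ht s, fun Qs hQs => ?_, ?_⟩⟩
    · have hq := solvesToda_specialQ (t₀ := t₀) hQ hQs
      have hE : ∀ t ∈ Set.Ioi t₀, todaEnergy Qs (specialQ Q t₀) t = 0 :=
        fun t ht => todaEnergy_specialQ hQ hQs ht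
      have hQs0 : ∀ s, Qs s ≠ 0 := fun s hs => hQ (by simpa [hs] using (hQs s).symm)
      have h := hq.solvesFieldEquations isOpen_Ioi hQs0 hE
      exact ⟨hq, hE, h 0, h _, h _⟩
    · refine ⟨synchronousTime Q t₀, contDiffOn_synchronousTime hQ, bijOn_synchronousTime hQ,
        fun t ht => ?_, fun x hx => braneMetric_specialQ hQ hx⟩
      rw [(hasDerivAt_synchronousTime hQ ht).deriv]
      exact neg_ne_zero.2 (Real.exp_pos _).ne'
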